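/- **Setting.** Let $\mathcal K\subseteq\mathbb R^d$ be closed and convex with $\mathbb B(r)\subseteq\mathcal K\subseteq\mathbb B(R)$ for some $r,R>0$, where $\mathbb B(\rho)$ is the closed Euclidean ball of radius $\rho$ around $0$; put $\kappa=R/r$. A separation oracle for $\mathcal K$ is a map $\mathrm{Sep}:w\mapsto(b,v)$ with $\|v\|\le1$ such that $(b,v)=(0,0)$ if $w\in\mathcal K$, and $b=1$, $\langle v,w\rangle>\langle v,y\rangle$ for all $y\in\mathcal K$ if $w\notin\mathcal K$. Let $G>0$, $c\in(0,1)$ and let $T\ge1$ be an integer. **GaugeDist$(w;\varepsilon,r)$.** If $w\in\mathcal K$ (as told by $\mathrm{Sep}$), return $(S,s)=(0,0)$. Otherwise set $\alpha=0$, $\beta=1$ and let $v$ be the vector returned by $\mathrm{Sep}(w)$. While $\beta-\alpha>\frac{r^2\varepsilon}{2\|w\|^2}$, put $\mu=(\alpha+\beta)/2$ and query $\mathrm{Sep}(\mu w)$; if $\mu w\in\mathcal K$ set $\alpha=\mu$, otherwise set $\beta=\mu$ and let $v$ be the vector just returned. Return $S=\alpha^{-1}-1$ and $s=v/(\beta\langle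 v,w\rangle)$. **Barrier-ONS$(T,\eta,\nu,c)$ over $\mathbb B(R)$.** Let $m=\lceil\mathfrak c\,\log_{1/c}(dT)\rceil$, with $\mathfrak c$ a constant, and $u_1=z_1=0$. In round $t$ output $u_t$, receive a loss vector $\tilde g_t$, put $$\Phi_{t+1}(x)=-\nu\log(R^2-\|x\|^2)+\tfrac\eta2\sum_{s\le t}\langle\tilde g_s,x-u_s\rangle^2+\Big\langle x,\sum_{s\le t}\tilde g_s\Big\rangle,$$ $$\Sigma_t=\Big(\tfrac{2\nu I}{R^2-\|z_t\|^2}+\tfrac{4\nu u_tu_t^\top}{(R^2-\|u_t\|^2)^2}+\eta\sum_{s\le t}\tilde g_s\tilde g_s^\top\Big)^{-1},\qquad \gamma_t=\tfrac{2\nu}{R^2-\|z_t\|^2}-\tfrac{2\nu}{R^2-\|u_t\|^2},$$ $H_t=\sum_{k=1}^{m+1}\gamma_t^{k-1}\Sigma_t^k$ and $u_{t+1}=u_t-H_t\nabla\Phi_{t+1}(u_t)$. Then set $z_{t+1}=z_t$ if $\big|\|u_{t+1}\|^2-\|z_t\|^2\big|\le c\,(R^2-\|u_{t+1}\|^2)$,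 and $z_{t+1}=u_{t+1}$ otherwise. **Reduction with gauge projections.** In each round $t=1,\dots,T$ let $u_t$ be the output of Barrier-ONS$(T,\eta,\nu,c)$ given the loss vectors $\tilde g_1,\dots,\tilde g_{t-1}$, let $(S_t,s_t)=\mathrm{GaugeDist}(u_t;1/T,r)$ and play $w_t=u_t/(1+S_t)$. A convex function $f_t:\mathcal K\to\mathbb R$ is chosen, possibly depending on the history and on $w_t$, and a subgradient $g_t\in\partial f_t(w_t)$ with $\|g_t\|\le G$ is observed. Send $\tilde g_t=g_t-\mathbb 1\{\langle g_t,u_t\rangle<0\}\,\langle g_t,w_t\rangle\,s_t$ to Barrier-ONS as its $t$-th loss vector. **Proposition.** There is a universal constant $\mathfrak c_0>0$ such that the following holds for every $\mathfrak c\ge\mathfrak c_0$ and for all $d,T,c,\mathcal K,r,R,G$, separation oracles and $f_t,g_t$ as above. If $0<\eta\le\frac1{10\kappa RG}$ and $20\kappa GR\le\nu\le20d\kappa GR$, then for every $w\in\operatorname{int}\mathcal K$ $$\sum_{t=1}^T\langle g_t,w_t-w\rangle\le\frac\eta2\sum_{t=1}^T\langle g_t,w_t-w\rangle^2+5\kappa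 GR-\nu\log\Big(1-\frac{\|w\|^2}{R^2}\Big)+\frac{4d\log(1+T/d)}{\eta}.$$ -/

import Mathlib

open scoped RealInnerProductSpace

noncomputable section

namespace ProjFree

/-- The Euclidean space `ℝ^d`. -/
abbrev Vec (d : ℕ) : Type := EuclideanSpace ℝ (Fin d)

/-- `g` is a subgradient at `w` of the function `f`, regarded as a function on `K`. -/
def IsSubgradientOn {d : ℕ} (K : Set (Vec d)) (f : Vec d → ℝ) (w g : Vec d) : Prop :=
  ∀ y ∈ K, f w + ⟪g, y - w⟫ ≤ f y

/-! ### Separation oracles and the approximate gauge distance -/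

/-- A separation oracle for `C`: the answer is a pair `(b, v)` with `v` in the closed unit ball;
`(b, v) = (0, 0)` (here `b = false`) if the query belongs to `C`, and otherwise `b = 1`
(here `b = true`) and `v` strictly separates the query from `C`. -/
def IsSeparationOracle {d : ℕ} (C : Set (Vec d)) (Sep : Vec d → Bool × Vec d) : Prop :=
  ∀ w : Vec d, ‖(Sep w).2‖ ≤ 1 ∧
    (w ∈ C → Sep w = (false, 0)) ∧
    (w ∉ C → (Sep w).1 = true ∧ ∀ y ∈ C, ⟪(Sep w).2, y⟫ < ⟪(Sep w).2, w⟫)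

/-- The variables of the bisection in `gaugeDist`: the end points `lo` and `hi` of the current
interval, and the vector `v` which the oracle returned for the query `hi • w`. -/
structure BisectState (d : ℕ) where
  lo : ℝ
  hi : ℝ
  v : Vec d

/-- One pass through the loop body of the bisection: query the midpoint `μ • w`; move the lower end
to `μ` if it is in the set, otherwise move the upper end to `μ` and store the separating vector. -/
def bisectStep {d : ℕ} (Sep : Vec d → Bool × Vec d) (w : Vec d) (s : BisectState d) :
    BisectState d :=
  if (Sep (((s.lo + s.hi) / 2) • w)).1 = false then
    { s with lo := (s.lo + s.hi) / 2 }
  else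
    { s with hi := (s.lo + s.hi) / 2, v := (Sep (((s.lo + s.hi) / 2) • w)).2 }

/-- The state of the bisection after `k` passes through the loop body. -/
def bisectState {d : ℕ} (Sep : Vec d → Bool × Vec d) (w : Vec d) (k : ℕ) : BisectState d :=
  (bisectStep Sep w)^[k] ⟨0, 1, (Sep w).2⟩

/-- The number of passes of the loop `while hi - lo > r² ε / (2 ‖w‖²)`. -/
def bisectCount {d : ℕ} (Sep : Vec d → Bool × Vec d) (w : Vec d) (ε r : ℝ) : ℕ :=
  sInf {k : ℕ | (bisectState Sep w k).hi - (bisectState Sep w k).lo ≤ r ^ 2 * ε / (2 * ‖w‖ ^ 2)}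

/-- The state of the bisection when the loop ends. -/
def bisectFinal {d : ℕ} (Sep : Vec d → Bool × Vec d) (w : Vec d) (ε r : ℝ) : BisectState d :=
  bisectState Sep w (bisectCount Sep w ε r)

/-- `GaugeDist`: approximate value and subgradient at `w` of the gauge distance function of the set
whose separation oracle is `Sep`. -/
def gaugeDist {d : ℕ} (Sep : Vec d → Bool × Vec d) (w : Vec d) (ε r : ℝ) : ℝ × Vec d :=
  if (Sep w).1 = false then (0, 0)
  else
    ((bisectFinal Sep w ε r).lo⁻¹ - 1,
      ((bisectFinal Sep w ε r).hi * ⟪(bisectFinal Sep w ε r).v, w⟫)⁻¹ • (bisectFinal Sep w ε r).v)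

/-! ### Barrier-ONS over the ball of radius `R` -/

/-- The parameters of Barrier-ONS: the radius `R` of the ball, `η`, `ν`, `c`, and the order `m` of
the Taylor expansions. -/
structure ONSParams where
  R : ℝ
  η : ℝ
  ν : ℝ
  c : ℝ
  m : ℕ

/-- The order `m = ⌈𝔠 log_{1/c} (dT)⌉` of the Taylor expansions. -/
def taylorOrder (C c : ℝ) (d T : ℕ) : ℕ :=
  ⌈C * Real.logb (1 / c) ((d : ℝ) * (T : ℝ))⌉₊

/-- The rank-one matrix `x xᵀ`. -/
def outer {d : ℕ} (x : Vec d) : Matrix (Fin d) (Fin d) ℝ :=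
  Matrix.vecMulVec x.ofLp x.ofLp

/-- `ν` times the log-barrier of the ball of radius `R`. -/
def barrier {d : ℕ} (R ν : ℝ) (x : Vec d) : ℝ :=
  -ν * Real.log (R ^ 2 - ‖x‖ ^ 2)

/-- The objective `Φ_{t+1}` determined by the history `[(u₁, g̃₁), …, (u_t, g̃_t)]`:
`Φ_{t+1}(x) = Ψ(x) + (η/2) ∑_{s≤t} ⟨g̃_s, x - u_s⟩² + ⟨x, ∑_{s≤t} g̃_s⟩`. -/
def objective {d : ℕ} (R η ν : ℝ) (hist : List (Vec d × Vec d)) (x : Vec d) : ℝ :=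
  barrier R ν x + η / 2 * (hist.map fun p => ⟪p.2, x - p.1⟫ ^ 2).sum
    + ⟪x, (hist.map Prod.snd).sum⟫

/-- The state of Barrier-ONS at the beginning of round `t`: the iterate `u_t`, the Taylor expansion
point `z_t`, and the history `[(u₁, g̃₁), …, (u_{t-1}, g̃_{t-1})]`. -/
structure ONSState (d : ℕ) where
  u : Vec d
  z : Vec d
  hist : List (Vec d × Vec d)

/-- The matrix `Σ_t`; here `hist` contains the rounds `1, …, t`. -/
def sigmaMatrix {d : ℕ} (p : ONSParams) (u z : Vec d) (hist : List (Vec d × Vec d)) :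
    Matrix (Fin d) (Fin d) ℝ :=
  ((2 * p.ν / (p.R ^ 2 - ‖z‖ ^ 2)) • (1 : Matrix (Fin d) (Fin d) ℝ)
    + (4 * p.ν / (p.R ^ 2 - ‖u‖ ^ 2) ^ 2) • outer u
    + p.η • (hist.map fun q => outer q.2).sum)⁻¹

/-- The scalar `γ_t`. -/
def gammaCoeff {d : ℕ} (p : ONSParams) (u z : Vec d) : ℝ :=
  2 * p.ν / (p.R ^ 2 - ‖z‖ ^ 2) - 2 * p.ν / (p.R ^ 2 - ‖u‖ ^ 2)

/-- The matrix `H_t = ∑_{k=1}^{m+1} γ_t^{k-1} Σ_t^k`. -/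
def approxInvHessian {d : ℕ} (p : ONSParams) (u z : Vec d) (hist : List (Vec d × Vec d)) :
    Matrix (Fin d) (Fin d) ℝ :=
  ∑ k ∈ Finset.Icc 1 (p.m + 1), gammaCoeff p u z ^ (k - 1) • sigmaMatrix p u z hist ^ k

/-- The approximate Newton step `u_{t+1} = u_t - H_t ∇Φ_{t+1}(u_t)`. -/
def newtonStep {d : ℕ} (p : ONSParams) (u z : Vec d) (hist : List (Vec d × Vec d)) : Vec d :=
  u - Matrix.toEuclideanLin (approxInvHessian p u z hist)
        (gradient (objective p.R p.η p.ν hist) u)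

/-- The update of the Taylor expansion point: `z` is kept as long as
`|‖u'‖² - ‖z‖²| ≤ c (R² - ‖u'‖²)` for the new iterate `u'`, and is replaced by `u'` otherwise. -/
def expansionPoint {d : ℕ} (p : ONSParams) (u' z : Vec d) : Vec d :=
  if |‖u'‖ ^ 2 - ‖z‖ ^ 2| ≤ p.c * (p.R ^ 2 - ‖u'‖ ^ 2) then z else u'

/-- One round of Barrier-ONS, on receiving the loss vector `g`. -/
def onsStep {d : ℕ} (p : ONSParams) (s : ONSState d) (g : Vec d) : ONSState d where
  u := newtonStep p s.u s.z (s.hist ++ [(s.u, g)])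
  z := expansionPoint p (newtonStep p s.u s.z (s.hist ++ [(s.u, g)])) s.z
  hist := s.hist ++ [(s.u, g)]

/-- The state of Barrier-ONS after the loss vectors `[g̃₁, …, g̃_{t-1}]`. -/
def onsState {d : ℕ} (p : ONSParams) (losses : List (Vec d)) : ONSState d :=
  losses.foldl (onsStep p) ⟨0, 0, []⟩

/-- Barrier-ONS as an online algorithm: the output `u_t` after the loss vectors
`[g̃₁, …, g̃_{t-1}]`. -/
def barrierONS {d : ℕ} (p : ONSParams) (losses : List (Vec d)) : Vec d :=
  (onsState p losses).u

/-! ### The reduction with gauge projections -/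

/-- The point `w = u / (1 + S)` played when the subroutine outputs `u`. -/
def playedPoint {d : ℕ} (Sep : Vec d → Bool × Vec d) (ε r : ℝ) (u : Vec d) : Vec d :=
  (1 + (gaugeDist Sep u ε r).1)⁻¹ • u

/-- The surrogate subgradient `g̃ = g - 𝟙{⟨g, u⟩ < 0} ⟨g, w⟩ s`. -/
def surrogateGrad {d : ℕ} (Sep : Vec d → Bool × Vec d) (ε r : ℝ) (u g : Vec d) : Vec d :=
  g - ((if ⟪g, u⟫ < 0 then 1 else 0) * ⟪g, playedPoint Sep ε r u⟫) • (gaugeDist Sep u ε r).2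

/-- The loss vectors `[g̃₁, …, g̃_t]` sent in rounds `1, …, t` to the subroutine `A` (a map from the
list of past loss vectors to the next output), when the subgradients observed are `g 1, …, g t`. -/
def lossVectors {d : ℕ} (A : List (Vec d) → Vec d) (Sep : Vec d → Bool × Vec d) (ε r : ℝ)
    (g : ℕ → Vec d) : ℕ → List (Vec d)
  | 0 => []
  | t + 1 => lossVectors A Sep ε r g t ++
      [surrogateGrad Sep ε r (A (lossVectors A Sep ε r g t)) (g (t + 1))]

/-- The output `u_t`, `t ≥ 1`, of the subroutine. -/
def subIterate {d : ℕ} (A : List (Vec d) → Vec d) (Sep : Vec d → Bool × Vec d) (ε r : ℝ)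
    (g : ℕ → Vec d) (t : ℕ) : Vec d :=
  A (lossVectors A Sep ε r g (t - 1))

/-- The point `w_t`, `t ≥ 1`, played in round `t` of `T` by the reduction (with accuracy
`ε = 1/T`). It depends on the subgradients `g 1, …, g (t-1)` of the earlier rounds only. -/
def reductionIterate {d : ℕ} (A : List (Vec d) → Vec d) (Sep : Vec d → Bool × Vec d) (r : ℝ)
    (T : ℕ) (g : ℕ → Vec d) (t : ℕ) : Vec d :=
  playedPoint Sep (1 / (T : ℝ)) r (subIterate A Sep (1 / (T : ℝ)) r g t)

/-- The point `w_t` of the reduction whose subroutine is Barrier-ONS on the ball of radius `R` with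
parameters `(T, η, ν, c)` and constant `C` in the order of the Taylor expansions. -/
def gaugeONSIterate {d : ℕ} (Sep : Vec d → Bool × Vec d) (r R η ν c C : ℝ) (T : ℕ)
    (g : ℕ → Vec d) (t : ℕ) : Vec d :=
  reductionIterate (barrierONS ⟨R, η, ν, c, taylorOrder C c d T⟩) Sep r T g t

end ProjFree

end

/-!
The regret of the reduction is bounded in two parts.

**Reduction.** When the iterate `u` is outside `K`, the bisection produces `α • u ∈ K` and a vector
separating `β • u` from `K`, with `β - α` of order `1 / T` (`gaugeDist_spec`). Hence the surrogate
gradient has norm at most `2 κ G`, and its linear loss dominates the true one up to `G r / (2 T)`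
(`norm_surrogateGrad_le`, `inner_le_surrogateGrad`). As `a ↦ a - η a² / 2` is increasing for
`a ≤ 1 / η`, the same holds for the quadratic losses (`sub_sq_le_of_le_add`), and the total error
`G r` is absorbed by `5 κ G R`.

**Barrier-ONS.** Let `Φ` be the objective before a round, `u` the iterate, and `Φ'` the objective
after the round. If `∇Φ'(u)` has dual norm `l`, small compared with `√ν`, for the Hessian form of
`Φ'` at `u`, then `Φ' ≥ Φ'(u) - 2 l²` on the ball (`objective_sub_le`). Applying the lower bound
already known for `Φ` at the point `u` and adding up the rounds, one gets
`Φ'(x) ≥ Ψ(0) + ∑ ⟪g̃, u⟫ - 2 ∑ l²` for every `x` in the ball, with no need for exact minimizers;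
this is the regret bound `Ψ(x) - Ψ(0) + 2 ∑ l²`.

To bound the decrements `l`, note that `l ≤ e + a`, where `a` is the dual norm of the new loss
vector and `e` that of the gradient left over by the previous Newton step. Here `a ≤ √ν / (10 √2)`
because `ν ≥ 20 κ G R`. The barrier of a ball is explicit enough to make its self-concordance a
matter of scalar inequalities (`ballHess_change`, `barrier_grad_remainder`). The truncated Neumann
series has relative error `c^(m+1) ≤ 2⁻¹⁰` in the energy norm (`approx_newton`,
`pow_taylorOrder_le`), since `|γ| Σ ≤ c` by the choice of the expansion point. Together they give
`e ≤ l / 5` for the next round (`newtonStep_spec`), so that `∑ l² ≤ (25 / 16) ∑ a²`. Finally `η a²`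
is at most the increase of `log det ((2ν/R²) I + η ∑ g̃ g̃ᵀ)` (`exists_dualBound_logdet`), whose
total increase is at most `d log (1 + T / d)` by the arithmetic-geometric mean inequality
(`log_det_gramMatrix_le`).
-/

noncomputable section

namespace ProjFree

/-! ### Scalar inequalities for the logarithmic barrier -/

theorem sq_div_four_le_neg_log {y : ℝ} (h₁ : -1 ≤ y) (h₂ : y < 1) :
    y ^ 2 / 4 ≤ -Real.log (1 - y) - y := by
  rcases le_total 0 y with hy | hy
  -- For `y ≥ 0` the bound `log (1 + t) ≥ 2 t / (t + 2)` is used with `t = y / (1 - y)`, for `y ≤ 0`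
  -- the bound `exp t ≥ 1 + t + t ^ 2 / 2` with `t = -y - y ^ 2 / 4`.
  · have h := Real.le_log_one_add_of_nonneg (x := y / (1 - y))
      (div_nonneg hy (by linarith))
    have h1 : (0 : ℝ) < 1 - y := by linarith
    have e1 : 1 + y / (1 - y) = (1 - y)⁻¹ := by field_simp; ring
    have e2 : 2 * (y / (1 - y)) / (y / (1 - y) + 2) = 2 * y / (2 - y) := by
      have : (2 : ℝ) - y ≠ 0 := by linarith
      have : y + 2 * (1 - y) ≠ 0 := by linarith
      field_simp
      ring
    rw [e1, e2, Real.log_inv] at h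
    have h3 : y + y ^ 2 / 4 ≤ 2 * y / (2 - y) := by
      rw [le_div_iff₀ (by linarith)]
      nlinarith [mul_nonneg hy hy, mul_nonneg (mul_nonneg hy hy) hy]
    linarith
  · have hw : (0 : ℝ) ≤ -y - y ^ 2 / 4 := by nlinarith
    have h := Real.quadratic_le_exp_of_nonneg hw
    have h2 : 1 - y ≤ Real.exp (-y - y ^ 2 / 4) := by
      refine le_trans ?_ h
      nlinarith [mul_nonneg (sq_nonneg y) (by linarith : (0 : ℝ) ≤ 1 + y),
        sq_nonneg (y ^ 2)]
    have := Real.log_le_log (by linarith : (0 : ℝ) < 1 - y) h2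
    rw [Real.log_exp] at this
    linarith

/-- The Bregman divergence of the log-barrier of a ball is `-log (1 - p - n) - p`, and
`p ^ 2 + 2 * n` is the squared local norm of the displacement. -/
theorem local_sq_div_eight_le {p n : ℝ} (hn : 0 ≤ n) (h : p + n < 1) (hτ : p ^ 2 + 2 * n ≤ 1) :
    (p ^ 2 + 2 * n) / 8 ≤ -Real.log (1 - p - n) - p := by
  have hp : -1 ≤ p := by nlinarith
  have h1 := sq_div_four_le_neg_log (y := p + n) (by linarith) h
  rw [show 1 - (p + n) = 1 - p - n by ring] at h1
  nlinarith [sq_nonneg (p + 2 * n)]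

/-- Far from the base point the Bregman divergence grows at least linearly in the local norm `τ`. -/
theorem local_div_eight_le {p n τ : ℝ} (hn : 0 ≤ n) (h : p + n < 1) (hτ : 1 ≤ τ)
    (e : τ ^ 2 = p ^ 2 + 2 * n) : τ / 8 ≤ -Real.log (1 - p - n) - p := by
  have hτ0 : 0 < τ := by linarith
  have hi0 : 0 ≤ τ⁻¹ := by positivity
  have hi1 : τ⁻¹ ≤ 1 := inv_le_one_of_one_le₀ hτ
  have hmul : τ * τ⁻¹ = 1 := mul_inv_cancel₀ hτ0.ne'
  -- The divergence is convex along the segment and vanishes at its start.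
  have hge : (1 - τ⁻¹) * 1 + τ⁻¹ * (1 - p - n) ≤ 1 - τ⁻¹ * p - τ⁻¹ ^ 2 * n := by
    nlinarith [mul_nonneg (mul_nonneg hi0 (by linarith : 0 ≤ 1 - τ⁻¹)) hn]
  have hpos : 0 < (1 - τ⁻¹) * 1 + τ⁻¹ * (1 - p - n) := by
    have : 0 < τ⁻¹ := by positivity
    nlinarith [mul_pos this (by linarith : 0 < 1 - p - n)]
  have hloc := local_sq_div_eight_le (p := τ⁻¹ * p) (n := τ⁻¹ ^ 2 * n) (by positivity)
    (by linarith) (by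
      have : (τ⁻¹ * p) ^ 2 + 2 * (τ⁻¹ ^ 2 * n) = τ⁻¹ ^ 2 * τ ^ 2 := by rw [e]; ring
      rw [this, ← mul_pow, mul_comm, hmul]; norm_num)
  have e2 : (τ⁻¹ * p) ^ 2 + 2 * (τ⁻¹ ^ 2 * n) = 1 := by
    have : (τ⁻¹ * p) ^ 2 + 2 * (τ⁻¹ ^ 2 * n) = (τ * τ⁻¹) ^ 2 := by rw [mul_pow τ, e]; ring
    rw [this, hmul]; norm_num
  rw [e2] at hloc
  have hconc := strictConcaveOn_log_Ioi.concaveOn.2 (x := (1 : ℝ)) (y := 1 - p - n)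
    (Set.mem_Ioi.2 one_pos) (Set.mem_Ioi.2 (by linarith)) (by linarith : 0 ≤ 1 - τ⁻¹) hi0
    (by ring)
  simp only [smul_eq_mul, Real.log_one, mul_zero, zero_add] at hconc
  have hlog := Real.log_le_log hpos hge
  have hfin : 1 / 8 ≤ τ⁻¹ * (-Real.log (1 - p - n) - p) := by nlinarith
  calc τ / 8 = τ * (1 / 8) := by ring
    _ ≤ τ * (τ⁻¹ * (-Real.log (1 - p - n) - p)) := mul_le_mul_of_nonneg_left hfin hτ0.le
    _ = (-Real.log (1 - p - n) - p) := by rw [← mul_assoc, hmul, one_mul]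

/-- A function whose gradient has dual norm at most `l` and whose Bregman divergence splits into
`ν D` (`D` as above) and half of a quadratic form `Q` is bounded below by `-2 l ^ 2`. -/
theorem neg_two_mul_sq_le {p n ν l Q : ℝ} (hn : 0 ≤ n) (h : p + n < 1) (hν : 0 < ν)
    (hl : 0 ≤ l) (hlν : l ≤ √ν / 8) (hQ : 0 ≤ Q) :
    -2 * l ^ 2 ≤ -(l * √(ν * (p ^ 2 + 2 * n) + Q))
      + ν * (-Real.log (1 - p - n) - p) + Q / 2 := by
  set s := √ν with hs
  have hs2 : s ^ 2 = ν := Real.sq_sqrt hν.le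
  have hs0 : 0 < s := Real.sqrt_pos.2 hν
  set τ := √(p ^ 2 + 2 * n) with hτ
  have hτ2 : τ ^ 2 = p ^ 2 + 2 * n := Real.sq_sqrt (by positivity)
  have hτ0 : 0 ≤ τ := Real.sqrt_nonneg _
  rcases le_total τ 1 with h1 | h1
  · have hD := local_sq_div_eight_le hn h (by rw [← hτ2]; nlinarith)
    have hX := Real.sq_sqrt (show 0 ≤ ν * (p ^ 2 + 2 * n) + Q by positivity)
    set X := √(ν * (p ^ 2 + 2 * n) + Q)
    have := mul_le_mul_of_nonneg_left hD hν.le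
    nlinarith [sq_nonneg (X - 4 * l)]
  · have hD := local_div_eight_le hn h h1 hτ2
    have hY := Real.sq_sqrt hQ
    have hY0 := Real.sqrt_nonneg Q
    set Y := √Q
    have hX : √(ν * (p ^ 2 + 2 * n) + Q) ≤ s * τ + Y := by
      rw [Real.sqrt_le_iff]
      refine ⟨by positivity, ?_⟩
      rw [← hτ2, ← hs2, ← hY]
      nlinarith [mul_nonneg (mul_nonneg hs0.le hτ0) hY0]
    have h2 := mul_le_mul_of_nonneg_left hX hl
    have h3 := mul_le_mul_of_nonneg_left hD hν.le
    have h4 : l * (s * τ) ≤ ν * (τ / 8) := by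
      rw [← hs2]
      nlinarith [mul_nonneg hs0.le hτ0]
    nlinarith [sq_nonneg (Y - l), sq_nonneg l]

/-- With `t = √(2 n)`, the sum of the two coefficients in the remainder of a Newton step on the
barrier of a ball is quadratic in the local norm of the step. -/
theorem newton_remainder_coeff_le {p n t : ℝ} (ht : 0 ≤ t) (e : t ^ 2 = 2 * n)
    (hτ : p ^ 2 + 2 * n ≤ 1 / 100) :
    (n + (p + n) ^ 2 / (1 - p - n)) + t * (|p + n| / (1 - p - n))
      ≤ 17 / 10 * (p ^ 2 + 2 * n) := by
  have hp2 : |p| ^ 2 = p ^ 2 := sq_abs p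
  have hP0 := abs_nonneg p
  have hP : |p| ≤ 1 / 10 := by nlinarith
  have hpP := le_abs_self p
  have ht1 : t ≤ 1 / 10 := by nlinarith [sq_nonneg p]
  have hn : n ≤ t / 20 := by nlinarith
  have hn0 : 0 ≤ n := by nlinarith
  have hy : |p + n| ≤ |p| + t / 20 := by
    calc |p + n| ≤ |p| + |n| := abs_add_le _ _
      _ ≤ _ := by rw [abs_of_nonneg hn0]; linarith
  have hy0 := abs_nonneg (p + n)
  have hd : (895 : ℝ) / 1000 ≤ 1 - p - n := by linarith
  have h1 : (p + n) ^ 2 / (1 - p - n) ≤ (|p| + t / 20) ^ 2 / (895 / 1000) := by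
    have : (p + n) ^ 2 = |p + n| ^ 2 := (sq_abs _).symm
    rw [this]
    gcongr
  have h2 : |p + n| / (1 - p - n) ≤ (|p| + t / 20) / (895 / 1000) := by gcongr
  have h3 := mul_le_mul_of_nonneg_left h2 ht
  have h4 : n = t ^ 2 / 2 := by linarith
  rw [← hp2, ← e]
  nlinarith [sq_nonneg (|p| - t), sq_nonneg t, sq_nonneg |p|]

/-- Lower bound for the local norm at a nearby point: `q` and `k` are the coordinates of a vector at
the base point, and `1 - y` is the ratio of the two values of the barrier's argument. -/
theorem local_norm_change {q k ζ τ y : ℝ} (hτ : 0 ≤ τ) (hτ1 : τ ≤ 1 / 10)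
    (hy : 1 - y ≤ 1 + 21 / 20 * τ) (hy0 : 0 < 1 - y) (hk : 0 ≤ k) (hζ : |ζ| ≤ τ * k) :
    7 / 10 * (k ^ 2 + q ^ 2) ≤ k ^ 2 / (1 - y) + ((q + ζ) / (1 - y)) ^ 2 := by
  have hw : 1 - y ≤ 221 / 200 := by linarith
  have h1 : k ^ 2 / (221 / 200) ≤ k ^ 2 / (1 - y) := by gcongr
  have h2 : (q + ζ) ^ 2 / (5 / 4) ≤ ((q + ζ) / (1 - y)) ^ 2 := by
    rw [div_pow (q + ζ)]
    exact div_le_div_of_nonneg_left (sq_nonneg _) (by positivity) (by nlinarith)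
  have h3 : q ^ 2 - 1 / 10 * (q ^ 2 + k ^ 2) ≤ (q + ζ) ^ 2 := by
    have hz : |ζ| ≤ 1 / 10 * k := hζ.trans (by gcongr)
    have : |q * ζ| ≤ |q| * (1 / 10 * k) := by rw [abs_mul]; gcongr
    have := neg_abs_le (q * ζ)
    nlinarith [sq_nonneg (|q| - k), sq_abs q, sq_nonneg ζ]
  linarith [sq_nonneg k, sq_nonneg q]

/-! ### The logarithmic barrier of a ball -/

/-- The quadratic form of the Hessian at `u` of the barrier `-log (R² - ‖x‖²)`. -/
def ballHess {d : ℕ} (R : ℝ) (u x : Vec d) : ℝ :=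
  2 * ‖x‖ ^ 2 / (R ^ 2 - ‖u‖ ^ 2) + (2 * ⟪u, x⟫ / (R ^ 2 - ‖u‖ ^ 2)) ^ 2

variable {d : ℕ} {R : ℝ} {u h x : Vec d}

theorem sub_sq_norm_pos (hu : ‖u‖ < R) : 0 < R ^ 2 - ‖u‖ ^ 2 := by
  nlinarith [norm_nonneg u]

theorem ballHess_nonneg (hu : ‖u‖ < R) (x : Vec d) : 0 ≤ ballHess R u x := by
  have := sub_sq_norm_pos hu
  unfold ballHess; positivity

theorem sub_sq_norm_add (hu : ‖u‖ < R) (h : Vec d) :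
    R ^ 2 - ‖u + h‖ ^ 2 = (R ^ 2 - ‖u‖ ^ 2) *
      (1 - 2 * ⟪u, h⟫ / (R ^ 2 - ‖u‖ ^ 2) - ‖h‖ ^ 2 / (R ^ 2 - ‖u‖ ^ 2)) := by
  have := sub_sq_norm_pos hu
  rw [norm_add_sq_real]
  field_simp
  ring

/-- The Bregman divergence of the barrier in the local coordinates of the displacement. -/
theorem barrier_add (ν : ℝ) (hu : ‖u‖ < R) (huh : ‖u + h‖ < R) :
    barrier R ν (u + h) = barrier R ν u + ν * (2 * ⟪u, h⟫ / (R ^ 2 - ‖u‖ ^ 2))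
      + ν * (-Real.log (1 - 2 * ⟪u, h⟫ / (R ^ 2 - ‖u‖ ^ 2) - ‖h‖ ^ 2 / (R ^ 2 - ‖u‖ ^ 2))
        - 2 * ⟪u, h⟫ / (R ^ 2 - ‖u‖ ^ 2)) := by
  have hb := sub_sq_norm_pos hu
  have hb' := sub_sq_norm_pos huh
  have e := sub_sq_norm_add hu h
  unfold barrier
  rw [e] at hb' ⊢
  rw [Real.log_mul hb.ne' (pos_of_mul_pos_right hb' hb.le).ne']
  ring

theorem local_add_lt_one (hu : ‖u‖ < R) (huh : ‖u + h‖ < R) :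
    2 * ⟪u, h⟫ / (R ^ 2 - ‖u‖ ^ 2) + ‖h‖ ^ 2 / (R ^ 2 - ‖u‖ ^ 2) < 1 := by
  have hb := sub_sq_norm_pos hu
  have hb' := sub_sq_norm_pos huh
  rw [sub_sq_norm_add hu h] at hb'
  have := pos_of_mul_pos_right hb' hb.le
  linarith

theorem abs_local_le {τ : ℝ} (hτ : 0 ≤ τ) (hu : ‖u‖ < R) (hh : ballHess R u h ≤ τ ^ 2) :
    |2 * ⟪u, h⟫ / (R ^ 2 - ‖u‖ ^ 2)| ≤ τ ∧ ‖h‖ ^ 2 / (R ^ 2 - ‖u‖ ^ 2) ≤ τ ^ 2 / 2 := by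
  have hb := sub_sq_norm_pos hu
  unfold ballHess at hh
  have h0 : 0 ≤ 2 * ‖h‖ ^ 2 / (R ^ 2 - ‖u‖ ^ 2) := by positivity
  constructor
  · exact abs_le_of_sq_le_sq (by linarith) hτ
  · have := sq_nonneg (2 * ⟪u, h⟫ / (R ^ 2 - ‖u‖ ^ 2))
    rw [mul_div_assoc] at hh
    linarith

/-- The Dikin ellipsoid of radius `1 / 10` is contained in the ball. -/
theorem norm_add_lt_of_ballHess (hR : 0 < R) (hu : ‖u‖ < R) (hh : ballHess R u h ≤ (1 / 10) ^ 2) :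
    ‖u + h‖ < R := by
  have hb := sub_sq_norm_pos hu
  obtain ⟨h1, h2⟩ := abs_local_le (by norm_num) hu hh
  have h3 := le_abs_self (2 * ⟪u, h⟫ / (R ^ 2 - ‖u‖ ^ 2))
  have h4 : 0 < R ^ 2 - ‖u + h‖ ^ 2 := by
    rw [sub_sq_norm_add hu h]
    exact mul_pos hb (by linarith)
  exact lt_of_pow_lt_pow_left₀ 2 hR.le (by linarith)

theorem sq_two_mul_inner_div_le {b : ℝ} (hb : 0 < b) (h x : Vec d) :
    (2 * ⟪h, x⟫ / b) ^ 2 ≤ 2 * (‖h‖ ^ 2 / b) * (2 * ‖x‖ ^ 2 / b) := by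
  have hc : ⟪h, x⟫ ^ 2 ≤ ‖h‖ ^ 2 * ‖x‖ ^ 2 := by
    rw [← mul_pow, ← sq_abs]
    gcongr
    exact abs_real_inner_le_norm h x
  calc (2 * ⟪h, x⟫ / b) ^ 2 = 4 * ⟪h, x⟫ ^ 2 / b ^ 2 := by ring
    _ ≤ 4 * (‖h‖ ^ 2 * ‖x‖ ^ 2) / b ^ 2 := by gcongr
    _ = _ := by ring

/-- Two local norms at nearby points are comparable. -/
theorem ballHess_change {τ : ℝ} (hτ : 0 ≤ τ) (hτ1 : τ ≤ 1 / 10) (hR : 0 < R) (hu : ‖u‖ < R)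
    (hh : ballHess R u h ≤ τ ^ 2) (x : Vec d) :
    7 / 10 * ballHess R u x ≤ ballHess R (u + h) x := by
  have hb := sub_sq_norm_pos hu
  have huh := norm_add_lt_of_ballHess hR hu (hh.trans (by gcongr))
  have hb' := sub_sq_norm_pos huh
  have hy := local_add_lt_one hu huh
  obtain ⟨h1, h2⟩ := abs_local_le hτ hu hh
  have h3 := neg_abs_le (2 * ⟪u, h⟫ / (R ^ 2 - ‖u‖ ^ 2))
  have e := sub_sq_norm_add hu h
  set b := R ^ 2 - ‖u‖ ^ 2 with hbdef
  have hn0 : 0 ≤ ‖h‖ ^ 2 / b := by positivity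
  set y := 2 * ⟪u, h⟫ / b + ‖h‖ ^ 2 / b with hydef
  have hk2 : (√(2 * ‖x‖ ^ 2 / b)) ^ 2 = 2 * ‖x‖ ^ 2 / b := Real.sq_sqrt (by positivity)
  have key := local_norm_change (q := 2 * ⟪u, x⟫ / b) (k := √(2 * ‖x‖ ^ 2 / b))
    (ζ := 2 * ⟪h, x⟫ / b) (y := y) hτ hτ1 (by nlinarith) (by linarith) (Real.sqrt_nonneg _) (by
      apply abs_le_of_sq_le_sq _ (by positivity)
      rw [mul_pow, hk2]
      calc (2 * ⟪h, x⟫ / b) ^ 2 ≤ 2 * (‖h‖ ^ 2 / b) * (2 * ‖x‖ ^ 2 / b) :=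
            sq_two_mul_inner_div_le hb h x
        _ ≤ 2 * (τ ^ 2 / 2) * (2 * ‖x‖ ^ 2 / b) := by gcongr
        _ = τ ^ 2 * (2 * ‖x‖ ^ 2 / b) := by rw [mul_div_cancel₀ _ two_ne_zero])
  rw [hk2] at key
  have e' : R ^ 2 - ‖u + h‖ ^ 2 = b * (1 - y) := by rw [e, hydef]; ring
  unfold ballHess
  rw [← hbdef, e', inner_add_left]
  refine key.trans (le_of_eq ?_)
  have : 1 - y ≠ 0 := by linarith
  field_simp

/-- The error of the linearization of the gradient of the barrier is quadratic in the local norm of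
the displacement. -/
theorem barrier_grad_remainder {τ : ℝ} (hτ : 0 ≤ τ) (hτ1 : τ ≤ 1 / 10) (hR : 0 < R)
    (hu : ‖u‖ < R) (hh : ballHess R u h ≤ τ ^ 2) (x : Vec d) :
    |2 * ⟪u + h, x⟫ / (R ^ 2 - ‖u + h‖ ^ 2) - 2 * ⟪u, x⟫ / (R ^ 2 - ‖u‖ ^ 2)
      - (2 * ⟪h, x⟫ / (R ^ 2 - ‖u‖ ^ 2)
        + (2 * ⟪u, h⟫ / (R ^ 2 - ‖u‖ ^ 2)) * (2 * ⟪u, x⟫ / (R ^ 2 - ‖u‖ ^ 2)))|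
      ≤ 17 / 10 * τ ^ 2 * √(ballHess R u x) := by
  have hb := sub_sq_norm_pos hu
  have huh := norm_add_lt_of_ballHess hR hu (hh.trans (by gcongr))
  have hb' := sub_sq_norm_pos huh
  have hy := local_add_lt_one hu huh
  have e := sub_sq_norm_add hu h
  have hN : 0 ≤ ballHess R u x := ballHess_nonneg hu x
  have hpx : |2 * ⟪u, x⟫ / (R ^ 2 - ‖u‖ ^ 2)| ≤ √(ballHess R u x) := by
    apply Real.abs_le_sqrt
    unfold ballHess
    have : 0 ≤ 2 * ‖x‖ ^ 2 / (R ^ 2 - ‖u‖ ^ 2) := by positivity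
    linarith
  have hhx : |2 * ⟪h, x⟫ / (R ^ 2 - ‖u‖ ^ 2)|
      ≤ √(2 * (‖h‖ ^ 2 / (R ^ 2 - ‖u‖ ^ 2))) * √(ballHess R u x) := by
    rw [← Real.sqrt_mul (by positivity)]
    apply Real.abs_le_sqrt
    refine (sq_two_mul_inner_div_le hb h x).trans ?_
    unfold ballHess
    gcongr
    have := sq_nonneg (2 * ⟪u, x⟫ / (R ^ 2 - ‖u‖ ^ 2))
    linarith
  have hh' : (2 * ⟪u, h⟫ / (R ^ 2 - ‖u‖ ^ 2)) ^ 2 + 2 * (‖h‖ ^ 2 / (R ^ 2 - ‖u‖ ^ 2)) ≤ τ ^ 2 := by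
    refine le_trans (le_of_eq ?_) hh
    unfold ballHess
    ring
  set b := R ^ 2 - ‖u‖ ^ 2 with hbdef
  have hn0 : 0 ≤ ‖h‖ ^ 2 / b := by positivity
  have hco := newton_remainder_coeff_le (p := 2 * ⟪u, h⟫ / b) (n := ‖h‖ ^ 2 / b)
    (Real.sqrt_nonneg _) (Real.sq_sqrt (by positivity)) (hh'.trans (by nlinarith))
  have e' : 2 * ⟪u + h, x⟫ / (R ^ 2 - ‖u + h‖ ^ 2) =
      (2 * ⟪u, x⟫ / b + 2 * ⟪h, x⟫ / b) / (1 - 2 * ⟪u, h⟫ / b - ‖h‖ ^ 2 / b) := by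
    rw [e, inner_add_left, ← add_div, ← mul_add, div_div]
  rw [e']
  set p := 2 * ⟪u, h⟫ / b
  set n := ‖h‖ ^ 2 / b
  set px := 2 * ⟪u, x⟫ / b
  set hx := 2 * ⟪h, x⟫ / b
  set N := √(ballHess R u x)
  have hN0 : 0 ≤ N := Real.sqrt_nonneg _
  have hd : 0 < 1 - p - n := by linarith
  have e3 : (px + hx) / (1 - p - n) - px - (hx + p * px)
      = px * (n + (p + n) ^ 2 / (1 - p - n)) + hx * ((p + n) / (1 - p - n)) := by
    field_simp
    ring
  rw [e3]
  calc |px * (n + (p + n) ^ 2 / (1 - p - n)) + hx * ((p + n) / (1 - p - n))|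
      ≤ |px * (n + (p + n) ^ 2 / (1 - p - n))| + |hx * ((p + n) / (1 - p - n))| := abs_add_le _ _
    _ = |px| * (n + (p + n) ^ 2 / (1 - p - n)) + |hx| * (|p + n| / (1 - p - n)) := by
        rw [abs_mul, abs_mul, abs_div (p + n), abs_of_pos hd,
          abs_of_nonneg (show 0 ≤ n + (p + n) ^ 2 / (1 - p - n) by positivity)]
    _ ≤ N * (n + (p + n) ^ 2 / (1 - p - n)) + (√(2 * n) * N) * (|p + n| / (1 - p - n)) := by
        gcongr
    _ = ((n + (p + n) ^ 2 / (1 - p - n)) + √(2 * n) * (|p + n| / (1 - p - n))) * N := by ring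
    _ ≤ (17 / 10 * (p ^ 2 + 2 * n)) * N := by gcongr
    _ ≤ _ := by gcongr

/-! ### Newton steps with a truncated Neumann series -/

section Neumann

variable {E : Type*} [NormedAddCommGroup E] [InnerProductSpace ℝ E]
  {P S : Module.End ℝ E} {α β c : ℝ}

/-- The truncated Neumann series `∑_{k=1}^{m+1} γ^{k-1} S^k`. If `S` is the inverse of `β + P`, it
approximates the inverse of `β - γ + P`. -/
def neumannSum (S : Module.End ℝ E) (γ : ℝ) (m : ℕ) : Module.End ℝ E :=
  ∑ k ∈ Finset.Icc 1 (m + 1), γ ^ (k - 1) • S ^ k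

theorem mul_neumannSum (hS : (β • 1 + P) * S = 1) (m : ℕ) :
    (α • 1 + P) * neumannSum S (β - α) m = 1 - ((β - α) • S) ^ (m + 1) := by
  have hA : (α • 1 + P : Module.End ℝ E) * S = 1 - (β - α) • S := by
    have : (α • 1 + P : Module.End ℝ E) = (β • 1 + P) - (β - α) • 1 := by
      rw [sub_smul]; abel
    rw [this, sub_mul, hS, smul_mul_assoc, one_mul]
  have hsum : neumannSum S (β - α) m
      = S * ∑ k ∈ Finset.range (m + 1), ((β - α) • S) ^ k := by
    unfold neumannSum
    rw [Finset.mul_sum, ← Finset.Ico_add_one_right_eq_Icc, Finset.sum_Ico_eq_sum_range]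
    refine Finset.sum_congr rfl fun k _ => ?_
    rw [add_tsub_cancel_left, smul_pow, mul_smul_comm, add_comm, pow_succ']
  rw [hsum, ← mul_assoc, hA, mul_neg_geom_sum]

/-- `(β - α) S` contracts the energy of `α + P`, because `S` is at most `β⁻¹` and commutes with
`P`. -/
theorem energy_smul_le (hsym : ∀ x y, ⟪P x, y⟫ = ⟪x, P y⟫) (hpos : ∀ x, 0 ≤ ⟪P x, x⟫)
    (hα : 0 < α) (hβ : 0 < β) (hc : |β - α| ≤ c * β) (hS : (β • 1 + P) * S = 1) (x : E) :
    ⟪(α • 1 + P) (((β - α) • S) x), ((β - α) • S) x⟫ ≤ c ^ 2 * ⟪(α • 1 + P) x, x⟫ := by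
  have hx : (β • 1 + P) (S x) = x := by rw [← Module.End.mul_apply, hS]; rfl
  have hz : ((β - α) • S) x = (β - α) • S x := rfl
  rw [hz]
  generalize S x = z at *
  subst hx
  have h1 := hpos z
  have h2 := hpos (P z)
  have h3 : 0 ≤ ⟪z, z⟫ := real_inner_self_nonneg
  have h4 : 0 ≤ ⟪P z, P z⟫ := real_inner_self_nonneg
  have h6 : (β - α) ^ 2 ≤ c ^ 2 * β ^ 2 := by
    rw [← mul_pow]
    exact sq_le_sq.2 (hc.trans (le_abs_self _))
  simp only [LinearMap.add_apply, LinearMap.smul_apply, Module.End.one_apply, map_add, map_smul,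
    inner_add_left, inner_add_right, real_inner_smul_left, real_inner_smul_right]
  rw [real_inner_comm (P z) z, show ⟪P (P z), z⟫ = ⟪P z, P z⟫ from hsym _ _]
  have e : 0 ≤ α * ⟪z, z⟫ + ⟪P z, z⟫ := by positivity
  have h7 := mul_le_mul_of_nonneg_right h6 e
  have h8 : 0 ≤ c ^ 2 * (2 * β * (α * ⟪P z, z⟫ + ⟪P z, P z⟫)
      + (α * ⟪P z, P z⟫ + ⟪P (P z), P z⟫)) := by positivity
  nlinarith

theorem energy_pow_le (hsym : ∀ x y, ⟪P x, y⟫ = ⟪x, P y⟫) (hpos : ∀ x, 0 ≤ ⟪P x, x⟫)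
    (hα : 0 < α) (hβ : 0 < β) (hc : |β - α| ≤ c * β) (hS : (β • 1 + P) * S = 1) (k : ℕ) (x : E) :
    ⟪(α • 1 + P) ((((β - α) • S) ^ k) x), (((β - α) • S) ^ k) x⟫
      ≤ (c ^ k) ^ 2 * ⟪(α • 1 + P) x, x⟫ := by
  induction k with
  | zero => simp
  | succ k ih =>
    rw [pow_succ', Module.End.mul_apply]
    refine (energy_smul_le hsym hpos hα hβ hc hS _).trans ?_
    calc _ ≤ c ^ 2 * ((c ^ k) ^ 2 * ⟪(α • 1 + P) x, x⟫) := by gcongr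
      _ = _ := by ring

/-- The Neumann error term is self-adjoint. -/
theorem smul_pow_symm (hsym : ∀ x y, ⟪P x, y⟫ = ⟪x, P y⟫) (hS : (β • 1 + P) * S = 1) (γ : ℝ)
    (k : ℕ) (x y : E) : ⟪((γ • S) ^ k) x, y⟫ = ⟪x, ((γ • S) ^ k) y⟫ := by
  have hS1 : ∀ x y, ⟪S x, y⟫ = ⟪x, S y⟫ := by
    intro x y
    have hx : (β • 1 + P) (S x) = x := by rw [← Module.End.mul_apply, hS]; rfl
    have hy : (β • 1 + P) (S y) = y := by rw [← Module.End.mul_apply, hS]; rfl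
    conv_lhs => rw [← hy]
    conv_rhs => rw [← hx]
    simp [inner_add_left, inner_add_right, real_inner_smul_left, real_inner_smul_right, hsym]
  induction k generalizing x y with
  | zero => simp
  | succ k ih =>
    rw [pow_succ', Module.End.mul_apply, LinearMap.smul_apply, real_inner_smul_left, hS1, ih,
      ← real_inner_smul_right, ← LinearMap.map_smul, ← LinearMap.smul_apply,
      ← Module.End.mul_apply, ← pow_succ, pow_succ']

/-- `l` bounds the dual norm of `L` with respect to the seminorm `√q`. -/
def HasDualBound (L : E) (q : E → ℝ) (l : ℝ) : Prop :=
  ∀ x, |⟪L, x⟫| ≤ l * √(q x)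

/-- A Newton step with a truncated Neumann series: the residual of the Newton equation has small
dual norm, and the step has about the energy norm of the exact Newton step. -/
theorem approx_newton (hsym : ∀ x y, ⟪P x, y⟫ = ⟪x, P y⟫) (hpos : ∀ x, 0 ≤ ⟪P x, x⟫)
    (hα : 0 < α) (hβ : 0 < β) (hc0 : 0 ≤ c) (hc : |β - α| ≤ c * β) (hS : (β • 1 + P) * S = 1)
    (m : ℕ) {L : E} {l : ℝ} (hl : 0 ≤ l)
    (hL : HasDualBound L (fun x => ⟪(α • 1 + P) x, x⟫) l) :
    HasDualBound (L + (α • 1 + P) (-neumannSum S (β - α) m L))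
        (fun x => ⟪(α • 1 + P) x, x⟫) (c ^ (m + 1) * l) ∧
      ⟪(α • 1 + P) (-neumannSum S (β - α) m L), -neumannSum S (β - α) m L⟫
        ≤ ((1 + c ^ (m + 1)) * l) ^ 2 := by
  have hres : L + (α • 1 + P) (-neumannSum S (β - α) m L) = (((β - α) • S) ^ (m + 1)) L := by
    have := congrArg (fun T : Module.End ℝ E => T L) (mul_neumannSum (α := α) hS m)
    simp only [Module.End.mul_apply] at this
    rw [map_neg, this]
    simp
  have hb : HasDualBound (L + (α • 1 + P) (-neumannSum S (β - α) m L))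
      (fun x => ⟪(α • 1 + P) x, x⟫) (c ^ (m + 1) * l) := by
    intro x
    rw [hres, smul_pow_symm hsym hS]
    refine (hL _).trans ?_
    rw [mul_comm (c ^ (m + 1)), mul_assoc]
    refine mul_le_mul_of_nonneg_left ?_ hl
    rw [← Real.sqrt_sq (pow_nonneg hc0 (m + 1)), ← Real.sqrt_mul (sq_nonneg _)]
    exact Real.sqrt_le_sqrt (energy_pow_le hsym hpos hα hβ hc hS _ x)
  refine ⟨hb, ?_⟩
  set h := -neumannSum S (β - α) m L
  have hq : 0 ≤ ⟪(α • 1 + P) h, h⟫ := by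
    have := hpos h
    have h3 : 0 ≤ ⟪h, h⟫ := real_inner_self_nonneg
    simp only [LinearMap.add_apply, LinearMap.smul_apply, Module.End.one_apply,
      inner_add_left, real_inner_smul_left]
    positivity
  have h1 := hb h
  have h2 := hL h
  simp only [inner_add_left] at h1
  have h3 := Real.sq_sqrt hq
  have h4 := Real.sqrt_nonneg ⟪(α • 1 + P) h, h⟫
  set w := √⟪(α • 1 + P) h, h⟫
  have h5 := le_abs_self (⟪L, h⟫ + ⟪(α • 1 + P) h, h⟫)
  have h6 := neg_abs_le ⟪L, h⟫
  have h7 : w ≤ (1 + c ^ (m + 1)) * l := by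
    by_contra! hcon
    have : 0 ≤ (1 + c ^ (m + 1)) * l := by positivity
    nlinarith
  rw [← h3]
  gcongr

end Neumann

/-! ### The elliptical potential -/

section Potential

variable {d : ℕ}

theorem toEuclideanLin_outer (g x : Vec d) : Matrix.toEuclideanLin (outer g) x = ⟪g, x⟫ • g := by
  ext i
  simp [outer, Matrix.vecMulVec_mulVec, PiLp.inner_apply, dotProduct, mul_comm]

theorem toEuclideanLin_one (x : Vec d) :
    Matrix.toEuclideanLin (1 : Matrix (Fin d) (Fin d) ℝ) x = x := by
  ext i; simp

theorem inner_toEuclideanLin_sum_outer (hist : List (Vec d × Vec d)) (x y : Vec d) :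
    ⟪Matrix.toEuclideanLin (hist.map fun p => outer p.2).sum x, y⟫
      = (hist.map fun p => ⟪p.2, x⟫ * ⟪p.2, y⟫).sum := by
  induction hist with
  | nil => simp
  | cons p l ih =>
    simp only [List.map_cons, List.sum_cons, map_add, LinearMap.add_apply, inner_add_left, ih,
      toEuclideanLin_outer, real_inner_smul_left]

theorem outer_isHermitian (g : Vec d) : (outer g).IsHermitian := by
  ext i j
  simp [outer, Matrix.vecMulVec_apply, mul_comm]

theorem outer_posSemidef (g : Vec d) : (outer g).PosSemidef := by
  rw [← Matrix.isPositive_toEuclideanLin_iff]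
  refine ⟨Matrix.isSymmetric_toEuclideanLin_iff.2 (outer_isHermitian g), fun x => ?_⟩
  rw [toEuclideanLin_outer, real_inner_smul_left]
  exact mul_self_nonneg _

theorem sum_outer_posSemidef (hist : List (Vec d × Vec d)) :
    (hist.map fun p => outer p.2).sum.PosSemidef := by
  induction hist with
  | nil => exact Matrix.PosSemidef.zero
  | cons p l ih => exact (outer_posSemidef p.2).add ih

/-- The regularized Gram matrix `v₀ I + η ∑ g gᵀ` of the loss vectors in a history. -/
def gramMatrix (v₀ η : ℝ) (hist : List (Vec d × Vec d)) : Matrix (Fin d) (Fin d) ℝ :=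
  v₀ • 1 + η • (hist.map fun p => outer p.2).sum

theorem gramMatrix_posDef {v₀ η : ℝ} (hv : 0 < v₀) (hη : 0 ≤ η) (hist : List (Vec d × Vec d)) :
    (gramMatrix v₀ η hist).PosDef :=
  (Matrix.PosDef.one.smul hv).add_posSemidef ((sum_outer_posSemidef hist).smul hη)

theorem gramMatrix_append (v₀ η : ℝ) (hist : List (Vec d × Vec d)) (p : Vec d × Vec d) :
    gramMatrix v₀ η (hist ++ [p]) = gramMatrix v₀ η hist + η • outer p.2 := by
  simp [gramMatrix, add_assoc]

theorem inner_gramMatrix (v₀ η : ℝ) (hist : List (Vec d × Vec d)) (x : Vec d) :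
    ⟪Matrix.toEuclideanLin (gramMatrix v₀ η hist) x, x⟫
      = v₀ * ‖x‖ ^ 2 + η * (hist.map fun p => ⟪p.2, x⟫ ^ 2).sum := by
  simp only [gramMatrix, map_add, map_smul, LinearMap.add_apply, LinearMap.smul_apply,
    inner_add_left, real_inner_smul_left, toEuclideanLin_one, inner_toEuclideanLin_sum_outer,
    real_inner_self_eq_norm_sq]
  simp only [pow_two]

theorem det_add_smul_outer {V : Matrix (Fin d) (Fin d) ℝ} (hV : IsUnit V.det) (η : ℝ) (g : Vec d) :
    (V + η • outer g).det = V.det * (1 + η * ⟪g, Matrix.toEuclideanLin V⁻¹ g⟫) := by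
  have e : η • outer g =
      Matrix.replicateCol Unit (η • g.ofLp) * Matrix.replicateRow Unit g.ofLp := by
    rw [outer, ← Matrix.vecMulVec_eq, Matrix.smul_vecMulVec]
  rw [e, Matrix.det_add_replicateCol_mul_replicateRow hV]
  congr 1
  rw [Matrix.det_unique, Matrix.add_apply, Matrix.one_apply_eq]
  congr 1
  rw [Matrix.mul_assoc, ← Matrix.replicateCol_mulVec, Matrix.replicateRow_mul_replicateCol_apply,
    Matrix.mulVec_smul, dotProduct_smul, smul_eq_mul]
  congr 1
  rw [PiLp.inner_apply]
  simp [dotProduct, mul_comm]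

/-- The dual norm of `g` with respect to `V + η g gᵀ` is controlled by the increment of the
log-determinant. -/
theorem exists_dualBound_logdet {V : Matrix (Fin d) (Fin d) ℝ} (hV : V.PosDef) {η : ℝ} (hη : 0 < η)
    (g : Vec d) : ∃ a : ℝ, 0 ≤ a ∧
      η * a ^ 2 ≤ Real.log (V + η • outer g).det - Real.log V.det ∧
      HasDualBound g (fun x => ⟪Matrix.toEuclideanLin (V + η • outer g) x, x⟫) a := by
  have hdet : IsUnit V.det := (Matrix.isUnit_iff_isUnit_det _).1 hV.isUnit
  have hpos := (Matrix.isPositive_toEuclideanLin_iff.2 hV.posSemidef).2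
  have hsym := (Matrix.isPositive_toEuclideanLin_iff.2 hV.posSemidef).1
  set y := Matrix.toEuclideanLin V⁻¹ g with hy
  have hVy : Matrix.toEuclideanLin V y = g := by
    ext i
    simp [hy, Matrix.mulVec_mulVec, Matrix.mul_nonsing_inv _ hdet]
  set s := ⟪g, y⟫ with hs
  have hs0 : 0 ≤ s := by
    have := hpos y
    rwa [hVy] at this
  have hcs : ∀ x, ⟪g, x⟫ ^ 2 ≤ s * ⟪Matrix.toEuclideanLin V x, x⟫ := by
    intro x
    have h := discrim_le_zero (a := s) (b := -2 * ⟪g, x⟫)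
      (c := ⟪Matrix.toEuclideanLin V x, x⟫) (fun t => by
        have h1 : 0 ≤ ⟪Matrix.toEuclideanLin V (x - t • y), x - t • y⟫ := hpos (x - t • y)
        have h2 : ⟪Matrix.toEuclideanLin V x, y⟫ = ⟪g, x⟫ := by
          rw [← hVy, real_inner_comm]; exact (hsym y x).symm ▸ rfl
        simp only [map_sub, map_smul, hVy, inner_sub_left, inner_sub_right, real_inner_smul_left,
          real_inner_smul_right, h2, ← hs] at h1
        linarith)
    unfold discrim at h
    linarith
  have hd : (V + η • outer g).det = V.det * (1 + η * s) := det_add_smul_outer hdet η g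
  have h1s : 0 < 1 + η * s := by positivity
  refine ⟨√(s / (1 + η * s)), Real.sqrt_nonneg _, ?_, fun x => ?_⟩
  · rw [hd, Real.log_mul hV.det_pos.ne' h1s.ne', Real.sq_sqrt (by positivity), add_sub_cancel_left]
    have := Real.one_sub_inv_le_log_of_pos h1s
    refine le_trans (le_of_eq ?_) this
    field_simp
    ring
  · rw [← Real.sqrt_mul (by positivity)]
    apply Real.abs_le_sqrt
    have h := hcs x
    simp only [map_add, map_smul, LinearMap.add_apply, LinearMap.smul_apply, toEuclideanLin_outer,
      inner_add_left, real_inner_smul_left]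
    rw [div_mul_eq_mul_div, le_div_iff₀ h1s]
    nlinarith

/-- The arithmetic-geometric mean inequality for the eigenvalues of a positive definite matrix. -/
theorem log_det_le (hd : 0 < d) {V : Matrix (Fin d) (Fin d) ℝ} (hV : V.PosDef) :
    Real.log V.det ≤ d * Real.log (V.trace / d) := by
  have hd' : (0 : ℝ) < d := by exact_mod_cast hd
  have h := strictConcaveOn_log_Ioi.concaveOn.le_map_sum (t := Finset.univ)
    (w := fun _ : Fin d => (1 / d : ℝ)) (p := hV.1.eigenvalues) (fun _ _ => by positivity)
    (by simp [hd'.ne']) (fun i _ => Set.mem_Ioi.2 (hV.eigenvalues_pos i))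
  have e1 : V.det = ∏ i, hV.1.eigenvalues i := hV.1.det_eq_prod_eigenvalues
  have e2 : V.trace = ∑ i, hV.1.eigenvalues i := hV.1.trace_eq_sum_eigenvalues
  rw [e1, e2, Real.log_prod (fun i _ => (hV.eigenvalues_pos i).ne')]
  simp only [smul_eq_mul, ← Finset.mul_sum] at h
  rw [one_div, inv_mul_le_iff₀ hd'] at h
  rwa [div_eq_inv_mul]

theorem trace_outer (g : Vec d) : (outer g).trace = ‖g‖ ^ 2 := by
  simp [outer, Matrix.trace_vecMulVec, EuclideanSpace.norm_sq_eq, dotProduct, ← pow_two]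

theorem log_det_gramMatrix_le (hd : 0 < d) {v₀ η : ℝ} (hv : 0 < v₀) (hη : 0 ≤ η)
    (hist : List (Vec d × Vec d)) (hg : ∀ p ∈ hist, η * ‖p.2‖ ^ 2 ≤ v₀) :
    Real.log (gramMatrix v₀ η hist).det - Real.log (gramMatrix v₀ η ([] : List (Vec d × Vec d))).det
      ≤ d * Real.log (1 + hist.length / d) := by
  have hd' : (0 : ℝ) < d := by exact_mod_cast hd
  have h0 : (gramMatrix v₀ η ([] : List (Vec d × Vec d))).det = v₀ ^ d := by
    simp [gramMatrix]
  have htr : (gramMatrix v₀ η hist).trace ≤ v₀ * (d + hist.length) := by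
    have : η * ((hist.map fun p => outer p.2).sum).trace ≤ v₀ * hist.length := by
      induction hist with
      | nil => simp
      | cons p l ih =>
        have h1 := hg p (by simp)
        have h2 := ih fun q hq => hg q (by simp [hq])
        simp only [List.map_cons, List.sum_cons, Matrix.trace_add, trace_outer, List.length_cons,
          Nat.cast_add, Nat.cast_one]
        linarith
    simp only [gramMatrix, Matrix.trace_add, Matrix.trace_smul, Matrix.trace_one, smul_eq_mul,
      Fintype.card_fin]
    linarith
  have hpd := gramMatrix_posDef hv hη hist
  have h1 := log_det_le hd hpd
  have hne : Nonempty (Fin d) := ⟨⟨0, hd⟩⟩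
  have h2 : Real.log ((gramMatrix v₀ η hist).trace / d)
      ≤ Real.log (v₀ * (1 + hist.length / d)) := by
    apply Real.log_le_log (div_pos hpd.trace_pos hd')
    rw [div_le_iff₀ hd']
    refine htr.trans (le_of_eq ?_)
    field_simp
  rw [Real.log_mul hv.ne' (by positivity)] at h2
  rw [h0, Real.log_pow]
  nlinarith [mul_le_mul_of_nonneg_left h2 hd'.le]

end Potential

/-! ### The bisection and the surrogate gradients -/

section Gauge

variable {d : ℕ} {K : Set (Vec d)} {Sep : Vec d → Bool × Vec d} {w : Vec d} {r ε : ℝ}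

theorem sep_fst_eq_false_iff (hSep : IsSeparationOracle K Sep) (w : Vec d) :
    (Sep w).1 = false ↔ w ∈ K := by
  by_cases hw : w ∈ K
  · simp [(hSep w).2.1 hw, hw]
  · simp [((hSep w).2.2 hw).1, hw]

theorem bisectState_spec (hSep : IsSeparationOracle K Sep) (h0 : (0 : Vec d) ∈ K) (hw : w ∉ K)
    (k : ℕ) :
    0 ≤ (bisectState Sep w k).lo ∧
    (bisectState Sep w k).hi - (bisectState Sep w k).lo = (1 / 2) ^ k ∧
    (bisectState Sep w k).hi ≤ 1 ∧
    (bisectState Sep w k).lo • w ∈ K ∧ (bisectState Sep w k).hi • w ∉ K ∧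
    (bisectState Sep w k).v = (Sep ((bisectState Sep w k).hi • w)).2 := by
  induction k with
  | zero => simpa [bisectState, h0] using hw
  | succ k ih =>
    have e : bisectState Sep w (k + 1) = bisectStep Sep w (bisectState Sep w k) := by
      simp only [bisectState, Function.iterate_succ_apply']
    rw [e]
    obtain ⟨h1, h2, h3, h4, h5, h6⟩ := ih
    set s := bisectState Sep w k
    have hp : (0 : ℝ) < (1 / 2) ^ k := by positivity
    unfold bisectStep
    split_ifs with h
    · refine ⟨?_, ?_, h3, (sep_fst_eq_false_iff hSep _).1 h, h5, h6⟩
      · change 0 ≤ (s.lo + s.hi) / 2; linarith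
      · change s.hi - (s.lo + s.hi) / 2 = _; rw [pow_succ]; linarith
    · refine ⟨h1, ?_, ?_, h4, fun hc => h ((sep_fst_eq_false_iff hSep _).2 hc), rfl⟩
      · change (s.lo + s.hi) / 2 - s.lo = _; rw [pow_succ]; linarith
      · change (s.lo + s.hi) / 2 ≤ 1; linarith

theorem lt_norm_of_notMem (hr : Metric.closedBall (0 : Vec d) r ⊆ K) (hw : w ∉ K) : r < ‖w‖ := by
  by_contra! h
  exact hw (hr (by simpa using h))

/-- What the bisection returns outside `K`: a point `α • w` of `K` at a controlled distance from a
point `β • w` outside `K`, together with a vector separating the latter from `K`. -/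
theorem gaugeDist_spec (hSep : IsSeparationOracle K Sep) (hr0 : 0 < r)
    (hr : Metric.closedBall (0 : Vec d) r ⊆ K) (hε : 0 < ε) (hε1 : ε ≤ 1) (hw : w ∉ K) :
    ∃ (α β : ℝ) (v : Vec d), 0 < α ∧ α ≤ β ∧ β ≤ 1 ∧ β - α ≤ r ^ 2 * ε / (2 * ‖w‖ ^ 2) ∧
      r < β * ‖w‖ ∧ α • w ∈ K ∧ (∀ y ∈ K, ⟪v, y⟫ < β * ⟪v, w⟫) ∧
      gaugeDist Sep w ε r = (α⁻¹ - 1, (β * ⟪v, w⟫)⁻¹ • v) := by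
  have h0 : (0 : Vec d) ∈ K := hr (by simpa using hr0.le)
  have hwr := lt_norm_of_notMem hr hw
  have hw0 : 0 < ‖w‖ := hr0.trans hwr
  have htol : 0 < r ^ 2 * ε / (2 * ‖w‖ ^ 2) := by positivity
  have hne : {k : ℕ | (bisectState Sep w k).hi - (bisectState Sep w k).lo
      ≤ r ^ 2 * ε / (2 * ‖w‖ ^ 2)}.Nonempty := by
    obtain ⟨k, hk⟩ := exists_pow_lt_of_lt_one htol (by norm_num : (1 / 2 : ℝ) < 1)
    exact ⟨k, by rw [Set.mem_ofPred_eq, (bisectState_spec hSep h0 hw k).2.1]; exact hk.le⟩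
  have hlen : (bisectFinal Sep w ε r).hi - (bisectFinal Sep w ε r).lo
      ≤ r ^ 2 * ε / (2 * ‖w‖ ^ 2) := Nat.sInf_mem hne
  obtain ⟨h1, h2, h3, h4, h5, h6⟩ := bisectState_spec hSep h0 hw (bisectCount Sep w ε r)
  change 0 ≤ (bisectFinal Sep w ε r).lo at h1
  change (bisectFinal Sep w ε r).hi - (bisectFinal Sep w ε r).lo = _ at h2
  change (bisectFinal Sep w ε r).hi ≤ 1 at h3
  change (bisectFinal Sep w ε r).lo • w ∈ K at h4
  change (bisectFinal Sep w ε r).hi • w ∉ K at h5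
  change (bisectFinal Sep w ε r).v = (Sep ((bisectFinal Sep w ε r).hi • w)).2 at h6
  have hgd : gaugeDist Sep w ε r = ((bisectFinal Sep w ε r).lo⁻¹ - 1,
      ((bisectFinal Sep w ε r).hi * ⟪(bisectFinal Sep w ε r).v, w⟫)⁻¹ •
        (bisectFinal Sep w ε r).v) := by
    rw [gaugeDist, if_neg fun h => hw ((sep_fst_eq_false_iff hSep _).1 h)]
  have hp : (0 : ℝ) < (1 / 2) ^ bisectCount Sep w ε r := by positivity
  have hβ0 : 0 ≤ (bisectFinal Sep w ε r).hi := by linarith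
  have hβ : r < (bisectFinal Sep w ε r).hi * ‖w‖ := by
    have := lt_norm_of_notMem hr h5
    rwa [norm_smul, Real.norm_of_nonneg hβ0] at this
  refine ⟨_, _, _, ?_, by linarith, h3, hlen, hβ, h4, fun y hy => ?_, hgd⟩
  · have e1 : r ^ 2 * ε / (2 * ‖w‖ ^ 2) * ‖w‖ ≤ r / 2 := by
      rw [div_mul_eq_mul_div, div_le_iff₀ (by positivity)]
      calc r ^ 2 * ε * ‖w‖ ≤ r ^ 2 * 1 * ‖w‖ := by gcongr
        _ = r * ‖w‖ * r := by ring
        _ ≤ r * ‖w‖ * ‖w‖ := by gcongr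
        _ = _ := by ring
    have e2 := mul_le_mul_of_nonneg_right hlen hw0.le
    by_contra! hcon
    nlinarith
  · rw [← real_inner_smul_right, h6]
    exact ((hSep _).2.2 h5).2 y hy

theorem playedPoint_of_mem (hSep : IsSeparationOracle K Sep) (hw : w ∈ K) :
    playedPoint Sep ε r w = w := by
  simp [playedPoint, gaugeDist, (sep_fst_eq_false_iff hSep w).2 hw]

theorem surrogateGrad_of_mem (hSep : IsSeparationOracle K Sep) (hw : w ∈ K) (g : Vec d) :
    surrogateGrad Sep ε r w g = g := by
  simp [surrogateGrad, gaugeDist, (sep_fst_eq_false_iff hSep w).2 hw]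

theorem playedPoint_mem (hSep : IsSeparationOracle K Sep) (hr0 : 0 < r)
    (hr : Metric.closedBall (0 : Vec d) r ⊆ K) (hε : 0 < ε) (hε1 : ε ≤ 1) (u : Vec d) :
    playedPoint Sep ε r u ∈ K := by
  by_cases hu : u ∈ K
  · rwa [playedPoint_of_mem hSep hu]
  · obtain ⟨α, β, v, -, -, -, -, -, h, -, e⟩ := gaugeDist_spec hSep hr0 hr hε hε1 hu
    simpa [playedPoint, e] using h

theorem norm_surrogateGrad_le (hSep : IsSeparationOracle K Sep) (hr0 : 0 < r)
    (hr : Metric.closedBall (0 : Vec d) r ⊆ K) (hε : 0 < ε) (hε1 : ε ≤ 1) {R G : ℝ} (hrR : r ≤ R)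
    (hKR : K ⊆ Metric.closedBall 0 R) (u : Vec d) {g : Vec d} (hg : ‖g‖ ≤ G) :
    ‖surrogateGrad Sep ε r u g‖ ≤ 2 * (R / r) * G := by
  have hκ : 1 ≤ R / r := by rwa [le_div_iff₀ hr0, one_mul]
  have hG : 0 ≤ G := (norm_nonneg g).trans hg
  have hp := playedPoint_mem hSep hr0 hr hε hε1 u
  by_cases hu : u ∈ K
  · rw [surrogateGrad_of_mem hSep hu]
    nlinarith
  · obtain ⟨α, β, v, -, -, -, -, -, -, hv, e⟩ := gaugeDist_spec hSep hr0 hr hε hε1 hu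
    have hθ0 : 0 < β * ⟪v, u⟫ := by simpa using hv 0 (hr (by simpa using hr0.le))
    have hθ : r * ‖v‖ ≤ β * ⟪v, u⟫ := by
      have hy := hv ((r / ‖v‖) • v) (hr (by
        rw [mem_closedBall_zero_iff, norm_smul, Real.norm_of_nonneg (by positivity)]
        rcases eq_or_ne ‖v‖ 0 with h | h
        · simpa [h] using hr0.le
        · rw [div_mul_cancel₀ _ h]))
      rw [real_inner_smul_right, real_inner_self_eq_norm_sq] at hy
      refine le_trans (le_of_eq ?_) hy.le
      rcases eq_or_ne ‖v‖ 0 with h | h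
      · simp [h]
      · field_simp
    have hs : ‖(β * ⟪v, u⟫)⁻¹ • v‖ ≤ 1 / r := by
      rw [norm_smul, norm_inv, Real.norm_of_nonneg hθ0.le, inv_mul_le_iff₀ hθ0, mul_one_div,
        le_div_iff₀ hr0]
      linarith
    have hin : |⟪g, playedPoint Sep ε r u⟫| ≤ G * R := by
      refine (abs_real_inner_le_norm _ _).trans ?_
      have := hKR hp
      rw [mem_closedBall_zero_iff] at this
      gcongr
    have hind : |(if ⟪g, u⟫ < 0 then (1 : ℝ) else 0) * ⟪g, playedPoint Sep ε r u⟫| ≤ G * R := by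
      split_ifs
      · rwa [one_mul]
      · rw [zero_mul, abs_zero]; exact (abs_nonneg _).trans hin
    unfold surrogateGrad
    rw [e]
    calc _ ≤ ‖g‖ + ‖(((if ⟪g, u⟫ < 0 then (1 : ℝ) else 0) * ⟪g, playedPoint Sep ε r u⟫)) •
          ((β * ⟪v, u⟫)⁻¹ • v)‖ := norm_sub_le _ _
      _ ≤ G + G * R * (1 / r) := by
        rw [norm_smul, Real.norm_eq_abs]
        gcongr
        exact (abs_nonneg _).trans hin
      _ ≤ _ := by
        have : G * R * (1 / r) = G * (R / r) := by ring
        rw [this]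
        nlinarith

/-- The surrogate loss dominates the true loss, up to the accuracy of the bisection. -/
theorem inner_le_surrogateGrad (hSep : IsSeparationOracle K Sep) (hr0 : 0 < r)
    (hr : Metric.closedBall (0 : Vec d) r ⊆ K) (hε : 0 < ε) (hε1 : ε ≤ 1) (u : Vec d) {G : ℝ}
    {g : Vec d} (hg : ‖g‖ ≤ G) {x : Vec d} (hx : x ∈ K) :
    ⟪g, playedPoint Sep ε r u - x⟫ ≤ ⟪surrogateGrad Sep ε r u g, u - x⟫ + G * r * ε / 2 := by
  have hG : 0 ≤ G := (norm_nonneg g).trans hg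
  by_cases hu : u ∈ K
  · rw [surrogateGrad_of_mem hSep hu, playedPoint_of_mem hSep hu]
    have : 0 ≤ G * r * ε / 2 := by positivity
    linarith
  · obtain ⟨α, β, v, hα, hαβ, hβ, hlen, hβr, -, hv, e⟩ := gaugeDist_spec hSep hr0 hr hε hε1 hu
    have hu0 : 0 < ‖u‖ := hr0.trans (lt_norm_of_notMem hr hu)
    have hpl : playedPoint Sep ε r u = α • u := by simp [playedPoint, e]
    have hθ0 : 0 < β * ⟪v, u⟫ := by simpa using hv 0 (hr (by simpa using hr0.le))
    unfold surrogateGrad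
    rw [hpl, e]
    split_ifs with hneg
    · have hβ0 : 0 < β := hα.trans_le hαβ
      have hsx : (β * ⟪v, u⟫)⁻¹ * ⟪v, x⟫ ≤ 1 := by
        rw [inv_mul_le_iff₀ hθ0, mul_one]
        exact (hv x hx).le
      have hsu : (β * ⟪v, u⟫)⁻¹ * ⟪v, u⟫ = β⁻¹ := by
        rw [mul_inv, mul_assoc, inv_mul_cancel₀ (pos_of_mul_pos_right hθ0 hβ0.le).ne', mul_one]
      simp only [inner_sub_left, inner_sub_right, real_inner_smul_left, real_inner_smul_right,
        one_mul, hsu]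
      -- The loss in the bisection is at most `‖g‖ ‖u‖ (β - α) / β`.
      have hgu : -⟪g, u⟫ ≤ G * ‖u‖ := by
        have := abs_real_inner_le_norm g u
        have := neg_abs_le ⟪g, u⟫
        have : ‖g‖ * ‖u‖ ≤ G * ‖u‖ := by gcongr
        linarith
      have hdiff : (β - α) / β ≤ r * ε / (2 * ‖u‖) := by
        rw [div_le_iff₀ hβ0]
        refine hlen.trans ?_
        calc r ^ 2 * ε / (2 * ‖u‖ ^ 2) = r * ε / (2 * ‖u‖) * (r / ‖u‖) := by
              field_simp
          _ ≤ r * ε / (2 * ‖u‖) * β := by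
              gcongr
              rw [div_le_iff₀ hu0]
              exact hβr.le
      have hnn : 0 ≤ (β - α) / β := div_nonneg (by linarith) hβ0.le
      have hprod : -⟪g, u⟫ * ((β - α) / β) ≤ G * r * ε / 2 := by
        calc -⟪g, u⟫ * ((β - α) / β) ≤ G * ‖u‖ * (r * ε / (2 * ‖u‖)) := by gcongr
          _ = _ := by field_simp
      have hβi : (β - α) / β = 1 - α * β⁻¹ := by field_simp
      rw [hβi] at hprod
      have hq : 0 ≤ α * (-⟪g, u⟫) * (1 - (β * ⟪v, u⟫)⁻¹ * ⟪v, x⟫) :=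
        mul_nonneg (mul_nonneg hα.le (by linarith)) (by linarith)
      nlinarith
    · have h1 : 0 ≤ G * r * ε / 2 := by positivity
      simp only [inner_sub_right, real_inner_smul_right, zero_mul, zero_smul, sub_zero]
      push Not at hneg
      nlinarith

/-- The map `a ↦ a - η a² / 2` is increasing on `a ≤ 1 / η` and has slope at most two on
`|a| ≤ 1 / η`. -/
theorem sub_sq_le_of_le_add {a b η δ : ℝ} (hη : 0 < η) (ha : η * |a| ≤ 1) (hb : η * |b| ≤ 1)
    (hδ : 0 ≤ δ) (h : a ≤ b + δ) :
    a - η / 2 * a ^ 2 ≤ b - η / 2 * b ^ 2 + 2 * δ := by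
  have h1 := mul_le_mul_of_nonneg_left (le_abs_self a) hη.le
  have h2 := mul_le_mul_of_nonneg_left (le_abs_self b) hη.le
  have h3 := mul_le_mul_of_nonneg_left (neg_abs_le a) hη.le
  have h4 := mul_le_mul_of_nonneg_left (neg_abs_le b) hη.le
  have e : a - η / 2 * a ^ 2 - (b - η / 2 * b ^ 2) = (a - b) * (1 - (η * a + η * b) / 2) := by
    ring
  rcases le_total a b with hab | hab <;> nlinarith

end Gauge

/-! ### Gradient and Hessian of the objective -/

section Objective

variable {d : ℕ} {R η ν : ℝ} {hist : List (Vec d × Vec d)} {u h x : Vec d}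

/-- The quadratic form of the Hessian of the objective at `u`. -/
def hessForm (R η ν : ℝ) (hist : List (Vec d × Vec d)) (u x : Vec d) : ℝ :=
  ν * ballHess R u x + η * (hist.map fun p => ⟪p.2, x⟫ ^ 2).sum

/-- The gradient of the objective on the open ball, in closed form. -/
def objGrad (R η ν : ℝ) (hist : List (Vec d × Vec d)) (u : Vec d) : Vec d :=
  (2 * ν / (R ^ 2 - ‖u‖ ^ 2)) • u + η • (hist.map fun p => ⟪p.2, u - p.1⟫ • p.2).sum
    + (hist.map Prod.snd).sum

theorem sum_sq_nonneg (hist : List (Vec d × Vec d)) (x : Vec d) :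
    0 ≤ (hist.map fun p => ⟪p.2, x⟫ ^ 2).sum :=
  List.sum_nonneg (by
    intro a ha
    obtain ⟨p, -, rfl⟩ := List.mem_map.1 ha
    positivity)

theorem hessForm_append (p : Vec d × Vec d) :
    hessForm R η ν (hist ++ [p]) u x = hessForm R η ν hist u x + η * ⟪p.2, x⟫ ^ 2 := by
  simp [hessForm]; ring

theorem objGrad_append (g : Vec d) :
    objGrad R η ν (hist ++ [(u, g)]) u = objGrad R η ν hist u + g := by
  simp [objGrad]; abel

theorem objective_append (p : Vec d × Vec d) :
    objective R η ν (hist ++ [p]) x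
      = objective R η ν hist x + (η / 2 * ⟪p.2, x - p.1⟫ ^ 2 + ⟪x, p.2⟫) := by
  simp [objective, inner_add_right]; ring

theorem hessForm_nonneg (hη : 0 ≤ η) (hν : 0 ≤ ν) (hu : ‖u‖ < R) (x : Vec d) :
    0 ≤ hessForm R η ν hist u x :=
  add_nonneg (mul_nonneg hν (ballHess_nonneg hu x)) (mul_nonneg hη (sum_sq_nonneg hist x))

theorem inner_objGrad (x : Vec d) :
    ⟪objGrad R η ν hist u, x⟫ = ν * (2 * ⟪u, x⟫ / (R ^ 2 - ‖u‖ ^ 2))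
      + η * (hist.map fun p => ⟪p.2, u - p.1⟫ * ⟪p.2, x⟫).sum + ⟪(hist.map Prod.snd).sum, x⟫ := by
  have e : ⟪(hist.map fun p => ⟪p.2, u - p.1⟫ • p.2).sum, x⟫
      = (hist.map fun p => ⟪p.2, u - p.1⟫ * ⟪p.2, x⟫).sum := by
    induction hist with
    | nil => simp
    | cons p l ih =>
      simp only [List.map_cons, List.sum_cons, inner_add_left, ih, real_inner_smul_left]
  rw [objGrad, inner_add_left, inner_add_left, real_inner_smul_left, real_inner_smul_left, e]
  ring

theorem gradient_objective (hu : ‖u‖ < R) :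
    gradient (objective R η ν hist) u = objGrad R η ν hist u := by
  apply HasGradientAt.gradient
  have hb := sub_sq_norm_pos hu
  have h1 : HasGradientAt (barrier R ν) ((2 * ν / (R ^ 2 - ‖u‖ ^ 2)) • u) u := by
    rw [hasGradientAt_iff_hasFDerivAt]
    have hn : HasFDerivAt (fun x : Vec d => R ^ 2 - ‖x‖ ^ 2) (-(2 • innerSL ℝ u)) u := by
      simpa using (hasStrictFDerivAt_norm_sq u).hasFDerivAt.const_sub (R ^ 2)
    have := (hn.log hb.ne').const_mul (-ν)
    refine this.congr_fderiv ?_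
    ext y
    simp
    ring
  have h2 : HasGradientAt (fun x => η / 2 * (hist.map fun p => ⟪p.2, x - p.1⟫ ^ 2).sum)
      (η • (hist.map fun p => ⟪p.2, u - p.1⟫ • p.2).sum) u := by
    have : HasGradientAt (fun x => (hist.map fun p => ⟪p.2, x - p.1⟫ ^ 2).sum)
        ((2 : ℝ) • (hist.map fun p => ⟪p.2, u - p.1⟫ • p.2).sum) u := by
      induction hist with
      | nil => simpa using hasGradientAt_const u (0 : ℝ)
      | cons p l ih =>
        simp only [List.map_cons, List.sum_cons, smul_add]
        rw [hasGradientAt_iff_hasFDerivAt] at ih ⊢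
        have h3 : HasFDerivAt (fun x : Vec d => ⟪p.2, x - p.1⟫) (innerSL ℝ p.2) u :=
          (innerSL ℝ p.2).hasFDerivAt.comp u ((hasFDerivAt_id u).sub_const p.1)
        refine ((h3.pow 2).add ih).congr_fderiv ?_
        ext y
        simp [mul_assoc]
    rw [hasGradientAt_iff_hasFDerivAt] at this ⊢
    refine (this.const_mul (η / 2)).congr_fderiv ?_
    ext y
    simp
    ring
  have h3 : HasGradientAt (fun x : Vec d => ⟪x, (hist.map Prod.snd).sum⟫)
      (hist.map Prod.snd).sum u := by
    rw [hasGradientAt_iff_hasFDerivAt]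
    have := (innerSL ℝ (hist.map Prod.snd).sum).hasFDerivAt (x := u)
    refine (this.congr_of_eventuallyEq (.of_forall fun x => real_inner_comm _ _)).congr_fderiv ?_
    ext y; simp
  rw [hasGradientAt_iff_hasFDerivAt] at h1 h2 h3 ⊢
  refine ((h1.add h2).add h3).congr_fderiv ?_
  simp only [objGrad, map_add]

theorem objective_add (hu : ‖u‖ < R) (huh : ‖u + h‖ < R) :
    objective R η ν hist (u + h) = objective R η ν hist u + ⟪objGrad R η ν hist u, h⟫
      + ν * (-Real.log (1 - 2 * ⟪u, h⟫ / (R ^ 2 - ‖u‖ ^ 2) - ‖h‖ ^ 2 / (R ^ 2 - ‖u‖ ^ 2))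
        - 2 * ⟪u, h⟫ / (R ^ 2 - ‖u‖ ^ 2))
      + η * (hist.map fun p => ⟪p.2, h⟫ ^ 2).sum / 2 := by
  have e : (hist.map fun p => ⟪p.2, u + h - p.1⟫ ^ 2).sum
      = (hist.map fun p => ⟪p.2, u - p.1⟫ ^ 2).sum
        + 2 * (hist.map fun p => ⟪p.2, u - p.1⟫ * ⟪p.2, h⟫).sum
        + (hist.map fun p => ⟪p.2, h⟫ ^ 2).sum := by
    induction hist with
    | nil => simp
    | cons p l ih =>
      simp only [List.map_cons, List.sum_cons, ih]
      rw [show u + h - p.1 = (u - p.1) + h by abel, inner_add_right]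
      ring
  rw [inner_objGrad]
  unfold objective
  rw [e, barrier_add ν hu huh, inner_add_left, real_inner_comm (hist.map Prod.snd).sum h]
  ring

/-- A point where the gradient has small dual norm `l` minimizes the objective up to `2 l ^ 2`. -/
theorem objective_sub_le (hη : 0 ≤ η) (hν : 0 < ν) (hu : ‖u‖ < R) (hx : ‖x‖ < R) {l : ℝ}
    (hl : 0 ≤ l) (hlν : l ≤ √ν / 8)
    (hL : HasDualBound (objGrad R η ν hist u) (hessForm R η ν hist u) l) :
    objective R η ν hist u - 2 * l ^ 2 ≤ objective R η ν hist x := by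
  obtain ⟨h, rfl⟩ : ∃ h, x = u + h := ⟨x - u, by abel⟩
  have hb := sub_sq_norm_pos hu
  have key := neg_two_mul_sq_le (n := ‖h‖ ^ 2 / (R ^ 2 - ‖u‖ ^ 2)) (by positivity)
    (local_add_lt_one hu hx) hν hl hlν (mul_nonneg hη (sum_sq_nonneg hist h))
  have e : hessForm R η ν hist u h = ν * ((2 * ⟪u, h⟫ / (R ^ 2 - ‖u‖ ^ 2)) ^ 2
      + 2 * (‖h‖ ^ 2 / (R ^ 2 - ‖u‖ ^ 2))) + η * (hist.map fun p => ⟪p.2, h⟫ ^ 2).sum := by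
    unfold hessForm ballHess; ring
  rw [← e] at key
  have h1 := hL h
  have h2 := neg_abs_le ⟪objGrad R η ν hist u, h⟫
  rw [objective_add hu hx]
  linarith

/-- The part of the Hessian of the objective at `u` beyond the multiple of the identity. -/
def hessRest (R η ν : ℝ) (hist : List (Vec d × Vec d)) (u : Vec d) : Matrix (Fin d) (Fin d) ℝ :=
  (4 * ν / (R ^ 2 - ‖u‖ ^ 2) ^ 2) • outer u + η • (hist.map fun q => outer q.2).sum

theorem hessRest_posSemidef (hη : 0 ≤ η) (hν : 0 ≤ ν) : (hessRest R η ν hist u).PosSemidef :=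
  ((outer_posSemidef u).smul (by positivity)).add ((sum_outer_posSemidef hist).smul hη)

theorem inner_hess_apply (y x : Vec d) :
    ⟪((2 * ν / (R ^ 2 - ‖u‖ ^ 2)) • (1 : Module.End ℝ (Vec d))
        + Matrix.toEuclideanLin (hessRest R η ν hist u)) y, x⟫
      = ν * (2 * ⟪y, x⟫ / (R ^ 2 - ‖u‖ ^ 2)
          + (2 * ⟪u, y⟫ / (R ^ 2 - ‖u‖ ^ 2)) * (2 * ⟪u, x⟫ / (R ^ 2 - ‖u‖ ^ 2)))
        + η * (hist.map fun p => ⟪p.2, y⟫ * ⟪p.2, x⟫).sum := by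
  simp only [hessRest, map_add, map_smul, LinearMap.add_apply, LinearMap.smul_apply,
    Module.End.one_apply, inner_add_left, real_inner_smul_left, toEuclideanLin_outer,
    inner_toEuclideanLin_sum_outer]
  generalize R ^ 2 - ‖u‖ ^ 2 = b
  ring

theorem inner_hess_self :
    (fun x => ⟪((2 * ν / (R ^ 2 - ‖u‖ ^ 2)) • (1 : Module.End ℝ (Vec d))
        + Matrix.toEuclideanLin (hessRest R η ν hist u)) x, x⟫) = hessForm R η ν hist u := by
  funext x
  rw [inner_hess_apply, hessForm, ballHess, real_inner_self_eq_norm_sq]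
  simp only [pow_two]

/-- The rule for the expansion point makes `|γ| Σ ≤ c`, as `2 ν / (R² - ‖z‖²)` is a lower bound for
`Σ⁻¹`. -/
theorem abs_gammaCoeff_le {p : ONSParams} {z : Vec d} (hν : 0 < p.ν) (hu : ‖u‖ < p.R)
    (hz : ‖z‖ < p.R) (hc : |‖u‖ ^ 2 - ‖z‖ ^ 2| ≤ p.c * (p.R ^ 2 - ‖u‖ ^ 2)) :
    |gammaCoeff p u z| ≤ p.c * (2 * p.ν / (p.R ^ 2 - ‖z‖ ^ 2)) := by
  have hbu := sub_sq_norm_pos hu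
  have hbz := sub_sq_norm_pos hz
  have e : gammaCoeff p u z = 2 * p.ν / ((p.R ^ 2 - ‖z‖ ^ 2) * (p.R ^ 2 - ‖u‖ ^ 2))
      * (-(‖u‖ ^ 2 - ‖z‖ ^ 2)) := by
    unfold gammaCoeff; field_simp; ring
  rw [e, abs_mul, abs_neg, abs_of_pos (by positivity)]
  calc _ ≤ 2 * p.ν / ((p.R ^ 2 - ‖z‖ ^ 2) * (p.R ^ 2 - ‖u‖ ^ 2))
      * (p.c * (p.R ^ 2 - ‖u‖ ^ 2)) := by gcongr
    _ = _ := by field_simp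

theorem newtonStep_eq (p : ONSParams) {z : Vec d} (hu : ‖u‖ < p.R) :
    newtonStep p u z hist = u + -neumannSum (Matrix.toEuclideanLin (sigmaMatrix p u z hist))
      (gammaCoeff p u z) p.m (objGrad p.R p.η p.ν hist u) := by
  have hpow : ∀ (M : Matrix (Fin d) (Fin d) ℝ) (k : ℕ),
      Matrix.toEuclideanLin (M ^ k) = (Matrix.toEuclideanLin M : Module.End ℝ (Vec d)) ^ k := by
    intro M k
    induction k with
    | zero =>
      ext x; simp
    | succ k ih =>
      rw [pow_succ, pow_succ, ← ih]
      ext x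
      simp
  rw [newtonStep, gradient_objective hu, sub_eq_add_neg, approxInvHessian, neumannSum]
  simp only [map_sum, map_smul, hpow]

theorem hess_mul_sigma {p : ONSParams} {z : Vec d} (hη : 0 ≤ p.η) (hν : 0 < p.ν)
    (hz : ‖z‖ < p.R) :
    ((2 * p.ν / (p.R ^ 2 - ‖z‖ ^ 2)) • (1 : Module.End ℝ (Vec d))
      + Matrix.toEuclideanLin (hessRest p.R p.η p.ν hist u))
      * Matrix.toEuclideanLin (sigmaMatrix p u z hist) = 1 := by
  have hbz := sub_sq_norm_pos hz
  have hpd : ((2 * p.ν / (p.R ^ 2 - ‖z‖ ^ 2)) • (1 : Matrix (Fin d) (Fin d) ℝ)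
      + hessRest p.R p.η p.ν hist u).PosDef :=
    (Matrix.PosDef.one.smul (by positivity)).add_posSemidef (hessRest_posSemidef hη hν.le)
  have e : sigmaMatrix p u z hist = ((2 * p.ν / (p.R ^ 2 - ‖z‖ ^ 2)) •
      (1 : Matrix (Fin d) (Fin d) ℝ) + hessRest p.R p.η p.ν hist u)⁻¹ := by
    rw [sigmaMatrix, hessRest, add_assoc]
  have e2 : (2 * p.ν / (p.R ^ 2 - ‖z‖ ^ 2)) • (1 : Module.End ℝ (Vec d))
      + Matrix.toEuclideanLin (hessRest p.R p.η p.ν hist u)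
      = Matrix.toEuclideanLin ((2 * p.ν / (p.R ^ 2 - ‖z‖ ^ 2)) •
      (1 : Matrix (Fin d) (Fin d) ℝ) + hessRest p.R p.η p.ν hist u) := by
    rw [map_add, map_smul]
    congr 2
    exact LinearMap.ext fun x => (toEuclideanLin_one x).symm
  rw [e, e2]
  refine LinearMap.ext fun x => ?_
  rw [Module.End.mul_apply]
  apply (WithLp.ofLp_injective 2)
  rw [Matrix.ofLp_toLpLin, Matrix.ofLp_toLpLin, Matrix.toLin'_apply, Matrix.toLin'_apply,
    Matrix.mulVec_mulVec,
    Matrix.mul_nonsing_inv _ ((Matrix.isUnit_iff_isUnit_det _).1 hpd.isUnit), Matrix.one_mulVec]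
  rfl

/-- One approximate Newton step stays in the ball and reduces the dual norm of the gradient
fivefold, provided this dual norm is small compared with `√ν`. -/
theorem newtonStep_spec {p : ONSParams} {z : Vec d} (hR : 0 < p.R) (hη : 0 ≤ p.η) (hν : 0 < p.ν)
    (hc : 0 ≤ p.c) (hcm : p.c ^ (p.m + 1) ≤ 1 / 1024) (hu : ‖u‖ < p.R) (hz : ‖z‖ < p.R)
    (huz : |‖u‖ ^ 2 - ‖z‖ ^ 2| ≤ p.c * (p.R ^ 2 - ‖u‖ ^ 2)) {l : ℝ} (hl : 0 ≤ l)
    (hlν : l ≤ 91 / 1000 * √p.ν)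
    (hL : HasDualBound (objGrad p.R p.η p.ν hist u) (hessForm p.R p.η p.ν hist u) l) :
    ‖newtonStep p u z hist‖ < p.R ∧
      HasDualBound (objGrad p.R p.η p.ν hist (newtonStep p u z hist))
        (hessForm p.R p.η p.ν hist (newtonStep p u z hist)) (l / 5) := by
  have hbu := sub_sq_norm_pos hu
  have hbz := sub_sq_norm_pos hz
  have hpos := Matrix.isPositive_toEuclideanLin_iff.2
    (hessRest_posSemidef (R := p.R) (hist := hist) (u := u) hη hν.le)
  have hN := approx_newton (P := Matrix.toEuclideanLin (hessRest p.R p.η p.ν hist u))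
    (fun x y => hpos.1 x y) hpos.2
    (show 0 < 2 * p.ν / (p.R ^ 2 - ‖u‖ ^ 2) by positivity)
    (show 0 < 2 * p.ν / (p.R ^ 2 - ‖z‖ ^ 2) by positivity) hc
    (abs_gammaCoeff_le hν hu hz huz) (hess_mul_sigma hη hν hz) p.m hl
    (by rw [inner_hess_self]; exact hL)
  obtain ⟨h1, h2⟩ := hN
  have hstep := newtonStep_eq (hist := hist) p (z := z) hu
  rw [gammaCoeff] at hstep
  rw [inner_hess_self] at h1
  set h := -neumannSum (Matrix.toEuclideanLin (sigmaMatrix p u z hist))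
    (2 * p.ν / (p.R ^ 2 - ‖z‖ ^ 2) - 2 * p.ν / (p.R ^ 2 - ‖u‖ ^ 2)) p.m
    (objGrad p.R p.η p.ν hist u) with hdef
  rw [hstep]
  replace h2 : hessForm p.R p.η p.ν hist u h ≤ ((1 + p.c ^ (p.m + 1)) * l) ^ 2 := by
    rw [← inner_hess_self]; exact h2
  set s := √p.ν with hs
  have hs2 : s ^ 2 = p.ν := Real.sq_sqrt hν.le
  have hs0 : 0 < s := Real.sqrt_pos.2 hν
  set δ := p.c ^ (p.m + 1) with hδ
  have hδ0 : 0 ≤ δ := by positivity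
  -- `τ` bounds the local norm of the step with respect to the barrier alone.
  set τ := 1025 / 1024 * l / s with hτ
  have hτ0 : 0 ≤ τ := by positivity
  have hτ1' : τ ≤ 92 / 1000 := by
    rw [hτ, div_le_iff₀ hs0]; linarith
  have hτ1 : τ ≤ 1 / 10 := by linarith
  have hsτ : s * τ = 1025 / 1024 * l := by rw [hτ]; field_simp
  have hh : ballHess p.R u h ≤ τ ^ 2 := by
    have h3 : p.ν * ballHess p.R u h ≤ hessForm p.R p.η p.ν hist u h :=
      le_add_of_nonneg_right (mul_nonneg hη (sum_sq_nonneg hist h))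
    have h4 : ((1 + δ) * l) ^ 2 ≤ (1025 / 1024 * l) ^ 2 := by
      gcongr; linarith
    rw [← hsτ, mul_pow s, hs2] at h4
    exact le_of_mul_le_mul_left (h3.trans (h2.trans h4)) hν
  have huh : ‖u + h‖ < p.R := norm_add_lt_of_ballHess hR hu (hh.trans (by gcongr))
  refine ⟨huh, fun x => ?_⟩
  have hrem := barrier_grad_remainder hτ0 hτ1 hR hu hh x
  have hlin := h1 x
  have hsum : (hist.map fun q => ⟪q.2, u + h - q.1⟫ * ⟪q.2, x⟫).sum
      = (hist.map fun q => ⟪q.2, u - q.1⟫ * ⟪q.2, x⟫).sum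
        + (hist.map fun q => ⟪q.2, h⟫ * ⟪q.2, x⟫).sum := by
    rw [← List.sum_map_add]
    congr 1
    refine List.map_congr_left fun q _ => ?_
    rw [show u + h - q.1 = (u - q.1) + h by abel, inner_add_right]
    ring
  have e : ⟪objGrad p.R p.η p.ν hist (u + h), x⟫
      = ⟪objGrad p.R p.η p.ν hist u + ((2 * p.ν / (p.R ^ 2 - ‖u‖ ^ 2)) •
          (1 : Module.End ℝ (Vec d)) + Matrix.toEuclideanLin (hessRest p.R p.η p.ν hist u)) h, x⟫
        + p.ν * (2 * ⟪u + h, x⟫ / (p.R ^ 2 - ‖u + h‖ ^ 2) - 2 * ⟪u, x⟫ / (p.R ^ 2 - ‖u‖ ^ 2)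
      - (2 * ⟪h, x⟫ / (p.R ^ 2 - ‖u‖ ^ 2)
        + (2 * ⟪u, h⟫ / (p.R ^ 2 - ‖u‖ ^ 2)) * (2 * ⟪u, x⟫ / (p.R ^ 2 - ‖u‖ ^ 2)))) := by
    rw [inner_add_left (objGrad p.R p.η p.ν hist u), inner_hess_apply, inner_objGrad,
      inner_objGrad, hsum]
    ring
  have hq0 := hessForm_nonneg (hist := hist) hη hν.le hu x
  have hN : s * √(ballHess p.R u x) ≤ √(hessForm p.R p.η p.ν hist u x) := by
    rw [hs, ← Real.sqrt_mul hν.le]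
    exact Real.sqrt_le_sqrt (le_add_of_nonneg_right (mul_nonneg hη (sum_sq_nonneg hist x)))
  have hch : 7 / 10 * hessForm p.R p.η p.ν hist u x ≤ hessForm p.R p.η p.ν hist (u + h) x := by
    have h3 := mul_le_mul_of_nonneg_left (ballHess_change hτ0 hτ1 hR hu hh x) hν.le
    have h4 := mul_nonneg hη (sum_sq_nonneg hist x)
    unfold hessForm
    linarith
  -- The change of metric costs a factor `12 / 10`, which is more than `√(10 / 7)`.
  have hch' : 10 / 12 * √(hessForm p.R p.η p.ν hist u x)
      ≤ √(hessForm p.R p.η p.ν hist (u + h) x) := by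
    apply Real.le_sqrt_of_sq_le
    rw [mul_pow, Real.sq_sqrt hq0]
    linarith
  rw [e]
  set N := √(ballHess p.R u x)
  set Q := √(hessForm p.R p.η p.ν hist u x)
  have hQ0 : 0 ≤ Q := Real.sqrt_nonneg _
  have hlinQ : δ * l * Q ≤ 1 / 1024 * l * Q := by gcongr
  have hremQ : p.ν * (17 / 10 * τ ^ 2 * N) ≤ 17 / 10 * (1025 / 1024 * l) * (92 / 1000 * Q) := by
    calc p.ν * (17 / 10 * τ ^ 2 * N) = 17 / 10 * (s * τ) * (τ * (s * N)) := by rw [← hs2]; ring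
      _ ≤ 17 / 10 * (1025 / 1024 * l) * (τ * Q) := by
        rw [hsτ]; gcongr
      _ ≤ _ := by gcongr
  have hB := mul_le_mul_of_nonneg_left hrem hν.le
  rw [← abs_of_pos hν, ← abs_mul, abs_of_pos hν] at hB
  refine (abs_add_le _ _).trans ((add_le_add hlin hB).trans ?_)
  have := mul_le_mul_of_nonneg_left hch' hl
  have := mul_nonneg hl hQ0
  linarith

end Objective

/-! ### Regret of Barrier-ONS -/

section Regret

variable {d : ℕ} {p : ONSParams} {hist : List (Vec d × Vec d)}

/-- The increase, over the rounds in a history, of the log-determinant of the Gram matrix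
`(2ν/R²) I + η ∑ g gᵀ`. -/
def logDetGain (p : ONSParams) (hist : List (Vec d × Vec d)) : ℝ :=
  Real.log (gramMatrix (2 * p.ν / p.R ^ 2) p.η hist).det
    - Real.log (gramMatrix (2 * p.ν / p.R ^ 2) p.η ([] : List (Vec d × Vec d))).det

/-- The objective is bounded below on the open ball by the minimum `Ψ(0)` of the barrier, plus the
losses `⟪gₛ, uₛ⟫`, minus `2 Λ`. In the argument `Λ` is the sum of the squared Newton decrements. -/
def HasLowerBound (p : ONSParams) (hist : List (Vec d × Vec d)) (Λ : ℝ) : Prop :=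
  ∀ x : Vec d, ‖x‖ < p.R → barrier p.R p.ν (0 : Vec d) + (hist.map fun q => ⟪q.2, q.1⟫).sum - 2 * Λ
    ≤ objective p.R p.η p.ν hist x

/-- The invariant of Barrier-ONS: the iterate and the expansion point are in the open ball and close
to each other; the gradient of the objective at the iterate has dual norm `e`, small compared with
`√ν`; and `e ^ 2`, together with the squared decrements `Λ` of the earlier rounds, is paid for by
the log-determinant.

The weights close up under a round that turns `e` into a decrement `l = e + a` and leaves
`e' ≤ l / 5`, since `5 / 4 * l ^ 2 ≤ 25 / 4 * e ^ 2 + 25 / 16 * a ^ 2` and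
`25 / 4 * e' ^ 2 ≤ l ^ 2 / 4`. -/
structure IsRegularState (p : ONSParams) (s : ONSState d) : Prop where
  norm_u_lt : ‖s.u‖ < p.R
  norm_z_lt : ‖s.z‖ < p.R
  close : |‖s.u‖ ^ 2 - ‖s.z‖ ^ 2| ≤ p.c * (p.R ^ 2 - ‖s.u‖ ^ 2)
  decrement : ∃ e Λ : ℝ, 0 ≤ e ∧ e ≤ √p.ν / 50 ∧
    HasDualBound (objGrad p.R p.η p.ν s.hist s.u) (hessForm p.R p.η p.ν s.hist s.u) e ∧
    p.η * (Λ + 25 / 4 * e ^ 2) ≤ 25 / 16 * logDetGain p s.hist ∧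
    HasLowerBound p s.hist Λ

theorem two_mul_norm_sq_div_le_ballHess {R : ℝ} {u : Vec d} (hu : ‖u‖ < R) (x : Vec d) :
    2 * ‖x‖ ^ 2 / R ^ 2 ≤ ballHess R u x := by
  have hb := sub_sq_norm_pos hu
  have : 2 * ‖x‖ ^ 2 / R ^ 2 ≤ 2 * ‖x‖ ^ 2 / (R ^ 2 - ‖u‖ ^ 2) := by
    gcongr
    linarith [sq_nonneg ‖u‖]
  exact this.trans (le_add_of_nonneg_right (sq_nonneg _))

theorem inner_gramMatrix_le_hessForm (hν : 0 ≤ p.ν) {u : Vec d} (hu : ‖u‖ < p.R) (x : Vec d) :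
    ⟪Matrix.toEuclideanLin (gramMatrix (2 * p.ν / p.R ^ 2) p.η hist) x, x⟫
      ≤ hessForm p.R p.η p.ν hist u x := by
  rw [inner_gramMatrix, hessForm]
  have := mul_le_mul_of_nonneg_left (two_mul_norm_sq_div_le_ballHess hu x) hν
  have e : 2 * p.ν / p.R ^ 2 * ‖x‖ ^ 2 = p.ν * (2 * ‖x‖ ^ 2 / p.R ^ 2) := by ring
  rw [e]
  gcongr

/-- A loss vector of norm at most `ν / (10 R)` has dual norm at most `√ν / (10 √2)`, which is less
than `71 / 1000 * √ν`. -/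
theorem hasDualBound_of_norm_le (hR : 0 < p.R) (hη : 0 ≤ p.η) (hν : 0 < p.ν) {u g : Vec d}
    (hu : ‖u‖ < p.R) (hg : ‖g‖ * p.R ≤ p.ν / 10) :
    HasDualBound g (hessForm p.R p.η p.ν hist u) (71 / 1000 * √p.ν) := by
  intro x
  rw [mul_assoc, ← Real.sqrt_mul hν.le, ← Real.sqrt_sq (show (0 : ℝ) ≤ 71 / 1000 by norm_num),
    ← Real.sqrt_mul (by positivity)]
  apply Real.abs_le_sqrt
  have h1 : p.ν * (2 * ‖x‖ ^ 2 / p.R ^ 2) ≤ hessForm p.R p.η p.ν hist u x :=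
    (mul_le_mul_of_nonneg_left (two_mul_norm_sq_div_le_ballHess hu x) hν.le).trans
      (le_add_of_nonneg_right (mul_nonneg hη (sum_sq_nonneg hist x)))
  have h2 : ‖g‖ ≤ p.ν / 10 / p.R := by rwa [le_div_iff₀ hR]
  calc ⟪g, x⟫ ^ 2 = |⟪g, x⟫| ^ 2 := (sq_abs _).symm
    _ ≤ (p.ν / 10 / p.R * ‖x‖) ^ 2 := by
      gcongr
      exact (abs_real_inner_le_norm g x).trans (by gcongr)
    _ = (1 / 200) * (p.ν * (p.ν * (2 * ‖x‖ ^ 2 / p.R ^ 2))) := by ring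
    _ ≤ (71 / 1000) ^ 2 * (p.ν * (p.ν * (2 * ‖x‖ ^ 2 / p.R ^ 2))) := by
      gcongr
      norm_num
    _ ≤ _ := by gcongr

/-- One round without its Newton step: the new loss vector adds its own dual norm to the Newton
decrement, and both are paid for by the log-determinant. -/
theorem IsRegularState.exists_decrement {s : ONSState d} (hs : IsRegularState p s) (hR : 0 < p.R)
    (hη : 0 < p.η) (hν : 0 < p.ν) {g : Vec d} (hg : ‖g‖ * p.R ≤ p.ν / 10) :
    ∃ l Λ : ℝ, 0 ≤ l ∧ l ≤ 91 / 1000 * √p.ν ∧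
      HasDualBound (objGrad p.R p.η p.ν (s.hist ++ [(s.u, g)]) s.u)
        (hessForm p.R p.η p.ν (s.hist ++ [(s.u, g)]) s.u) l ∧
      p.η * (Λ + l ^ 2 / 4) ≤ 25 / 16 * logDetGain p (s.hist ++ [(s.u, g)]) ∧
      HasLowerBound p (s.hist ++ [(s.u, g)]) Λ := by
  obtain ⟨hu, -, -, e, Λ, he0, heν, hdual, hpay, hlow⟩ := hs
  have hs0 : 0 < √p.ν := Real.sqrt_pos.2 hν
  have hv : 0 < 2 * p.ν / p.R ^ 2 := by positivity
  obtain ⟨a₁, ha0, ha1, ha2⟩ := exists_dualBound_logdet (gramMatrix_posDef hv hη.le s.hist) hη g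
  have happ := gramMatrix_append (2 * p.ν / p.R ^ 2) p.η s.hist (s.u, g)
  rw [← happ] at ha1 ha2
  -- The first bound is summable over the rounds, the second is small in each of them.
  set a := min a₁ (71 / 1000 * √p.ν) with ha
  have haa : 0 ≤ a := le_min ha0 (by positivity)
  have haν : a ≤ 71 / 1000 * √p.ν := min_le_right _ _
  have hapay : p.η * a ^ 2 ≤ logDetGain p (s.hist ++ [(s.u, g)]) - logDetGain p s.hist := by
    have : p.η * a ^ 2 ≤ p.η * a₁ ^ 2 := by
      gcongr
      exact min_le_left _ _
    unfold logDetGain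
    linarith
  have hgd : HasDualBound g (hessForm p.R p.η p.ν (s.hist ++ [(s.u, g)]) s.u) a := by
    intro x
    rw [ha, min_mul_of_nonneg _ _ (Real.sqrt_nonneg _)]
    refine le_min ((ha2 x).trans ?_) (hasDualBound_of_norm_le hR hη.le hν hu hg x)
    gcongr
    exact inner_gramMatrix_le_hessForm hν.le hu x
  have hdual' : HasDualBound (objGrad p.R p.η p.ν (s.hist ++ [(s.u, g)]) s.u)
      (hessForm p.R p.η p.ν (s.hist ++ [(s.u, g)]) s.u) (e + a) := by
    intro x
    rw [objGrad_append, inner_add_left, add_mul]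
    refine (abs_add_le _ _).trans (add_le_add ((hdual x).trans ?_) (hgd x))
    gcongr
    rw [hessForm_append]
    exact le_add_of_nonneg_right (by positivity)
  have hlν : e + a ≤ 91 / 1000 * √p.ν := by linarith
  refine ⟨e + a, Λ + (e + a) ^ 2, by positivity, hlν, hdual', ?_, fun x hx => ?_⟩
  · have : p.η * (5 / 4 * (e + a) ^ 2) ≤ p.η * (25 / 4 * e ^ 2 + 25 / 16 * a ^ 2) := by
      gcongr
      nlinarith [sq_nonneg (4 * e - a)]
    linarith
  · have h1 := objective_sub_le hη.le hν hu hx (by positivity) (by linarith) hdual'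
    have h2 := hlow s.u hu
    rw [objective_append] at h1
    simp only [List.map_append, List.map_cons, List.map_nil, List.sum_append, List.sum_cons,
      List.sum_nil, sub_self, inner_zero_right] at h1 ⊢
    have h3 := real_inner_comm s.u g
    linarith

theorem norm_expansionPoint_lt {u z : Vec d} (hu : ‖u‖ < p.R) (hz : ‖z‖ < p.R) :
    ‖expansionPoint p u z‖ < p.R := by
  unfold expansionPoint; split_ifs <;> assumption

theorem expansionPoint_close (hc : 0 ≤ p.c) {u z : Vec d} (hu : ‖u‖ < p.R) :
    |‖u‖ ^ 2 - ‖expansionPoint p u z‖ ^ 2| ≤ p.c * (p.R ^ 2 - ‖u‖ ^ 2) := by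
  unfold expansionPoint
  split_ifs with h
  · exact h
  · rw [sub_self, abs_zero]
    exact mul_nonneg hc (sub_sq_norm_pos hu).le

theorem IsRegularState.step {s : ONSState d} (hs : IsRegularState p s) (hR : 0 < p.R)
    (hη : 0 < p.η) (hν : 0 < p.ν) (hc : 0 ≤ p.c) (hcm : p.c ^ (p.m + 1) ≤ 1 / 1024)
    {g : Vec d} (hg : ‖g‖ * p.R ≤ p.ν / 10) : IsRegularState p (onsStep p s g) := by
  obtain ⟨l, Λ, hl0, hlν, hdual, hpay, hlow⟩ := hs.exists_decrement hR hη hν hg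
  obtain ⟨hu, hd⟩ := newtonStep_spec hR hη.le hν hc hcm hs.norm_u_lt hs.norm_z_lt hs.close hl0 hlν
    hdual
  refine ⟨hu, norm_expansionPoint_lt hu hs.norm_z_lt, expansionPoint_close hc hu,
    l / 5, Λ, by positivity, by linarith [Real.sqrt_nonneg p.ν], hd, ?_, hlow⟩
  refine le_trans (le_of_eq ?_) hpay
  ring

theorem isRegularState_init (hR : 0 < p.R) (hν : 0 < p.ν) (hc : 0 ≤ p.c) :
    IsRegularState p (onsState p ([] : List (Vec d))) := by
  refine ⟨by simpa [onsState] using hR, by simpa [onsState] using hR, ?_, 0, 0, le_rfl,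
    by positivity, fun x => ?_, ?_, fun x hx => ?_⟩
  · simp only [onsState, List.foldl_nil, sub_self, abs_zero, norm_zero, ne_eq, OfNat.ofNat_ne_zero,
      not_false_eq_true, zero_pow, sub_zero]
    positivity
  · simp [onsState, objGrad]
  · simp [onsState, logDetGain]
  · have hb := sub_sq_norm_pos hx
    have : Real.log (p.R ^ 2 - ‖x‖ ^ 2) ≤ Real.log (p.R ^ 2) :=
      Real.log_le_log hb (by linarith [sq_nonneg ‖x‖])
    have := mul_le_mul_of_nonneg_left this hν.le
    rw [Real.log_pow, Nat.cast_ofNat] at this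
    simp [onsState, objective, barrier]
    linarith

theorem isRegularState_onsState (hR : 0 < p.R) (hη : 0 < p.η) (hν : 0 < p.ν) (hc : 0 ≤ p.c)
    (hcm : p.c ^ (p.m + 1) ≤ 1 / 1024) (losses : List (Vec d))
    (hg : ∀ g ∈ losses, ‖g‖ * p.R ≤ p.ν / 10) : IsRegularState p (onsState p losses) := by
  induction losses using List.reverseRecOn with
  | nil => exact isRegularState_init hR hν hc
  | append_singleton l g ih =>
    rw [onsState, List.foldl_append, List.foldl_cons, List.foldl_nil]
    exact (ih fun q hq => hg q (by simp [hq])).step hR hη hν hc hcm (hg g (by simp))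

/-- The regret bound in the round after a regular state. -/
theorem IsRegularState.regret_le {s : ONSState d} (hs : IsRegularState p s) (hR : 0 < p.R)
    (hη : 0 < p.η) (hν : 0 < p.ν) {g : Vec d} (hg : ‖g‖ * p.R ≤ p.ν / 10)
    {x : Vec d} (hx : ‖x‖ < p.R) :
    ((s.hist ++ [(s.u, g)]).map fun q => ⟪q.2, q.1 - x⟫ - p.η / 2 * ⟪q.2, q.1 - x⟫ ^ 2).sum
      ≤ barrier p.R p.ν x - barrier p.R p.ν (0 : Vec d)
        + 25 / 8 * (logDetGain p (s.hist ++ [(s.u, g)]) / p.η) := by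
  obtain ⟨l, Λ, -, -, -, hpay, hlow⟩ := hs.exists_decrement hR hη hν hg
  have h1 := hlow x hx
  generalize s.hist ++ [(s.u, g)] = hist at *
  have e : (hist.map fun q => ⟪q.2, q.1 - x⟫ - p.η / 2 * ⟪q.2, q.1 - x⟫ ^ 2).sum
      = (hist.map fun q => ⟪q.2, q.1⟫).sum
        - (p.η / 2 * (hist.map fun q => ⟪q.2, x - q.1⟫ ^ 2).sum
          + ⟪x, (hist.map Prod.snd).sum⟫) := by
    clear hpay hlow h1
    induction hist with
    | nil => simp
    | cons q t ih =>
      simp only [List.map_cons, List.sum_cons, ih, inner_add_right]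
      rw [real_inner_comm q.2 x, inner_sub_right q.2 q.1 x, inner_sub_right q.2 x q.1]
      ring
  have h2 : 2 * Λ ≤ 25 / 8 * (logDetGain p hist / p.η) := by
    have h3 : Λ ≤ 25 / 16 * logDetGain p hist / p.η := by
      rw [le_div_iff₀ hη]
      have : 0 ≤ p.η * (l ^ 2 / 4) := by positivity
      linarith
    have h4 : 25 / 8 * (logDetGain p hist / p.η) = 2 * (25 / 16 * logDetGain p hist / p.η) := by
      ring
    linarith
  rw [e]
  unfold objective at h1
  linarith

end Regret

/-! ### The reduction -/

section Reduction

variable {d : ℕ}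

theorem onsState_hist_lossVectors (p : ONSParams) (Sep : Vec d → Bool × Vec d) (ε r : ℝ)
    (g : ℕ → Vec d) (t : ℕ) :
    (onsState p (lossVectors (barrierONS p) Sep ε r g t)).hist
      = (List.range t).map fun i => (subIterate (barrierONS p) Sep ε r g (i + 1),
          surrogateGrad Sep ε r (subIterate (barrierONS p) Sep ε r g (i + 1)) (g (i + 1))) := by
  induction t with
  | zero => simp [lossVectors, onsState]
  | succ t ih =>
    rw [List.range_succ, List.map_append, ← ih, lossVectors, onsState, List.foldl_append,
      List.foldl_cons, List.foldl_nil]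
    rfl

theorem mem_lossVectors {A : List (Vec d) → Vec d} {Sep : Vec d → Bool × Vec d} {ε r : ℝ}
    {g : ℕ → Vec d} {t : ℕ} {v : Vec d} (hv : v ∈ lossVectors A Sep ε r g t) :
    ∃ i u, 1 ≤ i ∧ i ≤ t ∧ v = surrogateGrad Sep ε r u (g i) := by
  induction t with
  | zero => simp [lossVectors] at hv
  | succ t ih =>
    rw [lossVectors, List.mem_append, List.mem_singleton] at hv
    rcases hv with hv | hv
    · obtain ⟨i, u, h1, h2, h3⟩ := ih hv
      exact ⟨i, u, h1, by omega, h3⟩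
    · exact ⟨t + 1, _, by omega, le_rfl, hv⟩

/-- For at least two rounds the truncation error of the Neumann series is at most `2⁻¹⁰`, because
`c ^ m ≤ (d T) ^ (-C)` for the order `m = ⌈C log_{1/c} (d T)⌉`, and `d T ≥ 2`. -/
theorem pow_taylorOrder_le {C c : ℝ} {T : ℕ} (hC : 10 ≤ C) (hc0 : 0 < c) (hc1 : c < 1)
    (hd : 1 ≤ d) (hT : 2 ≤ T) : c ^ (taylorOrder C c d T + 1) ≤ 1 / 1024 := by
  set m := taylorOrder C c d T with hm
  have hdT : (2 : ℝ) ≤ (d : ℝ) * T := by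
    have h1 : (1 : ℝ) ≤ d := by exact_mod_cast hd
    have h2 : (2 : ℝ) ≤ T := by exact_mod_cast hT
    nlinarith
  have hlc : 0 < Real.log (1 / c) := Real.log_pos (by rw [lt_div_iff₀ hc0]; linarith)
  have hl2 : Real.log 2 ≤ Real.log ((d : ℝ) * T) := Real.log_le_log two_pos hdT
  have hl20 : 0 < Real.log 2 := Real.log_pos one_lt_two
  have h1 : C * Real.logb (1 / c) ((d : ℝ) * T) ≤ m := Nat.le_ceil _
  rw [Real.logb, ← mul_div_assoc, div_le_iff₀ hlc] at h1
  have h2 : 10 * Real.log 2 ≤ m * Real.log (1 / c) := by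
    refine le_trans ?_ h1
    gcongr
  have h3 : Real.log (c ^ m) ≤ Real.log (1 / 1024) := by
    rw [Real.log_pow, show (1 / 1024 : ℝ) = (2 ^ 10)⁻¹ by norm_num, Real.log_inv, Real.log_pow]
    rw [one_div, Real.log_inv] at h2
    push_cast
    linarith
  have h4 : c ^ m ≤ 1 / 1024 :=
    (Real.log_le_log_iff (by positivity) (by norm_num)).1 h3
  calc c ^ (m + 1) = c ^ m * c := pow_succ _ _
    _ ≤ c ^ m * 1 := by gcongr
    _ ≤ _ := by rwa [mul_one]

theorem sum_Icc_one_eq_list_sum (F : ℕ → ℝ) (n : ℕ) :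
    ∑ t ∈ Finset.Icc 1 n, F t = ((List.range n).map fun i => F (i + 1)).sum := by
  induction n with
  | zero => simp
  | succ n ih => simp [Finset.sum_Icc_succ_top, List.range_succ, ih]

theorem le_of_closedBall_subset {K : Set (Vec d)} {r R : ℝ} (hd : 0 < d) (hr0 : 0 < r)
    (hr : Metric.closedBall (0 : Vec d) r ⊆ K) (hKR : K ⊆ Metric.closedBall 0 R) : r ≤ R := by
  have h1 : ‖EuclideanSpace.single (⟨0, hd⟩ : Fin d) r‖ = r := by
    simp [abs_of_pos hr0]
  have := hKR (hr (mem_closedBall_zero_iff.2 h1.le))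
  rwa [mem_closedBall_zero_iff, h1] at this

theorem norm_lt_of_mem_interior {K : Set (Vec d)} {R : ℝ} (hR : 0 < R)
    (hKR : K ⊆ Metric.closedBall 0 R) {x : Vec d} (hx : x ∈ interior K) : ‖x‖ < R := by
  have := interior_mono hKR hx
  rwa [interior_closedBall _ hR.ne', mem_ball_zero_iff] at this

end Reduction

end ProjFree
end
open ProjFree in
theorem mainTheorem4 :
    ∃ C₀ : ℝ, 0 < C₀ ∧ ∀ C : ℝ, C₀ ≤ C →
      ∀ (d T : ℕ) (c : ℝ), 1 ≤ T → 0 < c → c < 1 →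
      ∀ (K : Set (Vec d)) (r R G κ η ν : ℝ),
        IsClosed K → Convex ℝ K → 0 < r → 0 < R → 0 < G →
        Metric.closedBall 0 r ⊆ K → K ⊆ Metric.closedBall 0 R →
        κ = R / r →
        0 < η → η ≤ 1 / (10 * κ * R * G) →
        20 * κ * G * R ≤ ν → ν ≤ 20 * d * κ * G * R →
      ∀ Sep : Vec d → Bool × Vec d, IsSeparationOracle K Sep →
      ∀ (f : ℕ → Vec d → ℝ) (g w : ℕ → Vec d),
        (∀ t, 1 ≤ t → t ≤ T → w t = gaugeONSIterate Sep r R η ν c C T g t) →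
        (∀ t, 1 ≤ t → t ≤ T →
          ConvexOn ℝ K (f t) ∧ IsSubgradientOn K (f t) (w t) (g t) ∧ ‖g t‖ ≤ G) →
      ∀ x ∈ interior K,
        ∑ t ∈ Finset.Icc 1 T, inner ℝ (g t) (w t - x)
          ≤ η / 2 * ∑ t ∈ Finset.Icc 1 T, inner ℝ (g t) (w t - x) ^ 2
            + 5 * κ * G * R - ν * Real.log (1 - ‖x‖ ^ 2 / R ^ 2)
            + 4 * d * Real.log (1 + (T : ℝ) / d) / η := by
  refine ⟨10, by norm_num, fun C hC d T c hT hc0 hc1 K r R G κ η ν _ _ hr0 hR hG hr hKR hκ hη hηle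
    hν hνd Sep hSep f g w hw hf x hx => ?_⟩
  have hκ0 : 0 < κ := by rw [hκ]; positivity
  have hν0 : 0 < ν := lt_of_lt_of_le (by positivity) hν
  have hd : 0 < d := by
    rcases Nat.eq_zero_or_pos d with h | h
    · subst h
      simp at hνd
      linarith
    · exact h
  have hrR := le_of_closedBall_subset hd hr0 hr hKR
  have hκ1 : 1 ≤ κ := by rw [hκ, le_div_iff₀ hr0]; linarith
  have hx' := norm_lt_of_mem_interior hR hKR hx
  have hT0 : (0 : ℝ) < T := by exact_mod_cast hT
  have hT1 : (1 : ℝ) ≤ T := by exact_mod_cast hT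
  have hε : (0 : ℝ) < 1 / T := by positivity
  have hε1 : (1 : ℝ) / T ≤ 1 := by rw [div_le_one hT0]; exact hT1
  have hηκ : η * (10 * κ * R * G) ≤ 1 := (le_div_iff₀ (by positivity)).1 hηle
  set p : ONSParams := ⟨R, η, ν, c, taylorOrder C c d T⟩ with hp
  set u : ℕ → Vec d := subIterate (barrierONS p) Sep (1 / T) r g with hu
  set gs : ℕ → Vec d := fun t => surrogateGrad Sep (1 / T) r (u t) (g t) with hgs
  have hwt : ∀ t, 1 ≤ t → t ≤ T → w t = playedPoint Sep (1 / T) r (u t) := hw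
  have hgn : ∀ t, 1 ≤ t → t ≤ T → ∀ v, ‖surrogateGrad Sep (1 / T) r v (g t)‖ ≤ 2 * κ * G := by
    intro t h1 h2 v
    rw [hκ]
    exact norm_surrogateGrad_le hSep hr0 hr hε hε1 hrR hKR v (hf t h1 h2).2.2
  have hgν : ∀ v : Vec d, ‖v‖ ≤ 2 * κ * G → ‖v‖ * p.R ≤ p.ν / 10 := by
    intro v hv
    have : ‖v‖ * R ≤ 2 * κ * G * R := by gcongr
    change ‖v‖ * R ≤ ν / 10
    linarith
  -- For `T = 1` the truncation error need not be small, but then no Newton step matters.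
  have hreg : ∀ n, n < T →
      IsRegularState p (onsState p (lossVectors (barrierONS p) Sep (1 / T) r g n)) := by
    intro n hn
    rcases Nat.eq_zero_or_pos n with h0 | h0
    · subst h0
      exact isRegularState_init hR hν0 hc0.le
    · refine isRegularState_onsState hR hη hν0 hc0.le
        (pow_taylorOrder_le hC hc0 hc1 hd (by omega)) _ ?_
      intro v hv
      obtain ⟨i, y, h1, h2, rfl⟩ := mem_lossVectors hv
      exact hgν _ (hgn i h1 (by omega) y)
  have huR : ∀ t, 1 ≤ t → t ≤ T → ‖u t‖ < R := fun t h1 h2 => (hreg (t - 1) (by omega)).norm_u_lt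
  obtain ⟨n, rfl⟩ : ∃ n, T = n + 1 := ⟨T - 1, by omega⟩
  have hregret := (hreg n (by omega)).regret_le hR hη hν0 (g := gs (n + 1))
    (hgν _ (hgn (n + 1) (by omega) le_rfl _)) hx'
  have hhist : (onsState p (lossVectors (barrierONS p) Sep (1 / ((n + 1 : ℕ) : ℝ)) r g n)).hist
      ++ [((onsState p (lossVectors (barrierONS p) Sep (1 / ((n + 1 : ℕ) : ℝ)) r g n)).u,
        gs (n + 1))]
      = (List.range (n + 1)).map fun i => (u (i + 1), gs (i + 1)) := by
    rw [onsState_hist_lossVectors, List.range_succ, List.map_append]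
    rfl
  rw [hhist] at hregret
  have hgain : logDetGain p ((List.range (n + 1)).map fun i => (u (i + 1), gs (i + 1)))
      ≤ d * Real.log (1 + ((n + 1 : ℕ) : ℝ) / d) := by
    have := log_det_gramMatrix_le hd (v₀ := 2 * ν / R ^ 2) (by positivity) hη.le
      ((List.range (n + 1)).map fun i => (u (i + 1), gs (i + 1))) (by
        intro q hq
        obtain ⟨i, hi, rfl⟩ := List.mem_map.1 hq
        have hi' := List.mem_range.1 hi
        have h1 := hgn (i + 1) (by omega) (by omega) (u (i + 1))
        change η * ‖gs (i + 1)‖ ^ 2 ≤ 2 * ν / R ^ 2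
        rw [le_div_iff₀ (by positivity)]
        calc η * ‖gs (i + 1)‖ ^ 2 * R ^ 2 ≤ η * (2 * κ * G) ^ 2 * R ^ 2 := by gcongr
          _ = η * (10 * κ * R * G) * (2 / 5 * κ * G * R) := by ring
          _ ≤ 1 * (2 / 5 * κ * G * R) := by gcongr
          _ ≤ _ := by
            have : 0 < κ * G * R := by positivity
            linarith)
    simpa [logDetGain] using this
  rw [List.map_map] at hregret
  have hreg2 : ∑ t ∈ Finset.Icc 1 (n + 1), (⟪gs t, u t - x⟫ - η / 2 * ⟪gs t, u t - x⟫ ^ 2)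
      ≤ barrier R ν x - barrier R ν (0 : Vec d)
        + 25 / 8 *
          (logDetGain p ((List.range (n + 1)).map fun i => (u (i + 1), gs (i + 1))) / η) := by
    rw [sum_Icc_one_eq_list_sum]
    exact hregret
  have hround : ∀ t ∈ Finset.Icc 1 (n + 1),
      ⟪g t, w t - x⟫ - η / 2 * ⟪g t, w t - x⟫ ^ 2
        ≤ ⟪gs t, u t - x⟫ - η / 2 * ⟪gs t, u t - x⟫ ^ 2
          + 2 * (G * r * (1 / ((n + 1 : ℕ) : ℝ)) / 2) := by
    intro t ht
    obtain ⟨h1, h2⟩ := Finset.mem_Icc.1 ht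
    have hgt := (hf t h1 h2).2.2
    have hGR : 0 < η * (κ * R * G) := by positivity
    have hxR := hx'.le
    refine sub_sq_le_of_le_add hη ?_ ?_ (by positivity) ?_
    · have hwK := hKR (playedPoint_mem hSep hr0 hr hε hε1 (u t))
      rw [← hwt t h1 h2, mem_closedBall_zero_iff] at hwK
      calc η * |⟪g t, w t - x⟫| ≤ η * (G * (R + R)) := by
            gcongr
            refine (abs_real_inner_le_norm _ _).trans ?_
            gcongr
            exact (norm_sub_le _ _).trans (by gcongr)
        _ = 2 * (η * (1 * R * G)) := by ring
        _ ≤ 2 * (η * (κ * R * G)) := by gcongr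
        _ ≤ 1 := by linarith
    · calc η * |⟪gs t, u t - x⟫| ≤ η * (2 * κ * G * (R + R)) := by
            gcongr
            refine (abs_real_inner_le_norm _ _).trans ?_
            have := hgn t h1 h2 (u t)
            have := (huR t h1 h2).le
            gcongr
            exact (norm_sub_le _ _).trans (by gcongr)
        _ = 4 * (η * (κ * R * G)) := by ring
        _ ≤ 1 := by linarith
    · rw [hwt t h1 h2]
      exact inner_le_surrogateGrad hSep hr0 hr hε hε1 (u t) hgt (interior_subset hx)
  have hsum := Finset.sum_le_sum hround
  rw [Finset.sum_add_distrib, Finset.sum_const, Nat.card_Icc, nsmul_eq_mul,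
    Finset.sum_sub_distrib, ← Finset.mul_sum] at hsum
  have herr : ((n + 1 + 1 - 1 : ℕ) : ℝ) * (2 * (G * r * (1 / ((n + 1 : ℕ) : ℝ)) / 2)) = G * r := by
    rw [Nat.add_sub_cancel]
    field_simp
  rw [herr] at hsum
  have hGr : G * r ≤ 5 * κ * G * R := by
    have : G * r ≤ G * R := by gcongr
    have : 1 * (G * R) ≤ κ * (G * R) := by gcongr
    nlinarith [mul_pos hG hR]
  have hbar : barrier R ν x - barrier R ν (0 : Vec d) = -ν * Real.log (1 - ‖x‖ ^ 2 / R ^ 2) := by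
    have hb := sub_sq_norm_pos hx'
    have e : 1 - ‖x‖ ^ 2 / R ^ 2 = (R ^ 2 - ‖x‖ ^ 2) / R ^ 2 := by field_simp
    rw [e, Real.log_div hb.ne' (by positivity)]
    simp [barrier]
    ring
  have hfin : 25 / 8 *
      (logDetGain p ((List.range (n + 1)).map fun i => (u (i + 1), gs (i + 1))) / η)
      ≤ 4 * d * Real.log (1 + ((n + 1 : ℕ) : ℝ) / d) / η := by
    have hl : 0 ≤ (d : ℝ) * Real.log (1 + ((n + 1 : ℕ) : ℝ) / d) := by
      have : 0 ≤ Real.log (1 + ((n + 1 : ℕ) : ℝ) / d) :=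
        Real.log_nonneg (le_add_of_nonneg_right (by positivity))
      positivity
    rw [← mul_div_assoc]
    exact div_le_div_of_nonneg_right (by linarith) hη.le
  rw [hbar] at hreg2
  linarith
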